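/- **Lemma (edge reordering of a path in linear time).** A one-dimensional cellular automaton has a finite set $S$ of states and a local rule $f:S^3\to S$; writing $\langle c,t\rangle$ for the state of cell $c\in\mathbb Z$ at time $t$, one has $\langle c,t+1\rangle=f(\langle c-1,t\rangle,\langle c,t\rangle,\langle c+1,t\rangle)$. The input alphabet $I$ is embedded in $S\setminus\{\#\}$, where $\#\in S$ is a persistent border state, that is, $f(a,\#,b)=\#$ for all $a,b\in S$. On an input word $w\in I^*$ the initial configuration is $\langle i,0\rangle=w_i$ for $0\le i<|w|$ and $\langle i,0\rangle=\#$ for all other $i$. A function $\phi:I^*\to O^*$ with $|\phi(w)|=|w|$ for all $w$ is *computable in linear time* if there are a rational $k>1$, such an automaton, and a projection $\pi:S\to O$ with $\pi(\langle i,\lceil k|w|\rceil\rangle)=\phi(w)_i$ for every $w\in I^*$ and every $0\le i<|w|$. Vertices are binary words of a common length $\ell$ (numbers written with a fixed number of binary digits). A sequence of directed edges $(a_1,b_1),\dots,(a_n,b_n)$ is written as the word $a_1,b_1;a_2,b_2;\cdots a_n,b_n;$ over $I=\{0,1,\text{','},\text{';'}\}$, and a sequence of vertices $v_0,\dots,v_n$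 as the word $v_0,v_1,\cdots,v_n,$ (a comma after each vertex) over $O=\{0,1,\text{','},\text{blank}\}$. Then there is a function $\phi:I^*\to O^*$, computable in linear time, that reorders the edges of every path: for all $\ell\ge 0$, all $n\ge 1$, all pairwise distinct $v_0,\dots,v_n\in\{0,1\}^\ell$, and every ordering of the $n$ directed edges $(v_0,v_1),(v_1,v_2),\dots,(v_{n-1},v_n)$, the value of $\phi$ on the word coding these edges in that order is the word coding $v_0,v_1,\dots,v_n$, followed by blanks up to the length of the input. (Nothing is required of $\phi$ on other inputs. The automaton and $k$ do not depend on $\ell$ or $n$.) -/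

import Mathlib

namespace EdgeReordering

/-- A one-dimensional cellular automaton with nearest-neighbour local rule and finitely many
states. -/
structure CellularAutomaton where
  State : Type
  finite : Finite State
  rule : State → State → State → State

/-- One synchronous step on a configuration, i.e. a bi-infinite sequence of cell states. -/
def CellularAutomaton.step (A : CellularAutomaton) (c : ℤ → A.State) : ℤ → A.State :=
  fun i => A.rule (c (i - 1)) (c i) (c (i + 1))

/-- A cellular automaton used as a device on words over the input alphabet `I`: input letters are
states, there is a persistent state `border` (written `#`) which is not an input letter, and states
are projected to the output alphabet `O`. -/
structure WordAutomaton (I O : Type) extends CellularAutomaton where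
  border : State
  border_persistent : ∀ a b : State, rule a border b = border
  letter : I ↪ State
  letter_ne_border : ∀ a : I, letter a ≠ border
  proj : State → O

namespace WordAutomaton

variable {I O : Type} (A : WordAutomaton I O)

/-- The initial configuration on `w`: cell `i` holds the letter `w_i` for `0 ≤ i < |w|`, and every
other cell holds the border state. -/
def initial (w : List I) : ℤ → A.State :=
  fun i => if 0 ≤ i then (w[i.toNat]?).elim A.border A.letter else A.border

/-- The state of cell `c` at time `t` in the computation on the input word `w`. -/
def site (w : List I) (c : ℤ) (t : ℕ) : A.State :=
  (A.toCellularAutomaton.step)^[t] (A.initial w) c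

/-- The word displayed at time `t` on the cells `0, …, |w| - 1`. -/
def displayed (w : List I) (t : ℕ) : List O :=
  List.ofFn fun i : Fin w.length => A.proj (A.site w (i : ℕ) t)

end WordAutomaton

/-- `φ : I* → O*` is computable in linear time: for some rational `k > 1` and some automaton, the
cells `0, …, |w| - 1` display `φ w` at time `k |w|` (rounded up), for every input word `w`. -/
def ComputableInLinearTime {I O : Type} (φ : List I → List O) : Prop :=
  ∃ k : ℚ, 1 < k ∧ ∃ A : WordAutomaton I O,
    ∀ w : List I, A.displayed w ⌈k * (w.length : ℚ)⌉₊ = φ w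

/-- Vertices are numbers written in binary with a fixed number `l` of digits. -/
abbrev Vertex (l : ℕ) : Type := Fin l → Bool

/-- The input alphabet `{0, 1, ',', ';'}`. -/
inductive InSymbol where
  | bit (b : Bool)
  | comma
  | semicolon
  deriving DecidableEq

/-- The output alphabet `{0, 1, ',', blank}`. -/
inductive OutSymbol where
  | bit (b : Bool)
  | comma
  | blank
  deriving DecidableEq

/-- The edge from `u` to `v` is written `u,v;`. -/
def encodeEdge {l : ℕ} (e : Vertex l × Vertex l) : List InSymbol :=
  (List.ofFn e.1).map InSymbol.bit ++ [InSymbol.comma] ++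
    (List.ofFn e.2).map InSymbol.bit ++ [InSymbol.semicolon]

/-- A sequence of edges is written as the concatenation of the codes of its edges. -/
def encodeEdges {l : ℕ} (es : List (Vertex l × Vertex l)) : List InSymbol :=
  es.flatMap encodeEdge

/-- A sequence of vertices is written `v₀,v₁,…,vₙ,`. -/
def encodeVertices {l : ℕ} (p : List (Vertex l)) : List OutSymbol :=
  p.flatMap fun v => (List.ofFn v).map OutSymbol.bit ++ [OutSymbol.comma]

/-- The edges `(v₀,v₁), (v₁,v₂), …, (vₙ₋₁,vₙ)` joining consecutive vertices of `v₀, v₁, …, vₙ`. -/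
def consecutiveEdges {V : Type} (p : List V) : List (V × V) :=
  p.zip p.tail

/-- `es` lists, in an arbitrary order and each exactly once, the edges of the path that visits
successively the pairwise distinct vertices of `p`; the path has at least one edge. -/
def IsShuffledPath {V : Type} (p : List V) (es : List (V × V)) : Prop :=
  2 ≤ p.length ∧ p.Nodup ∧ es.Perm (consecutiveEdges p)

/-- `φ` solves the edge reordering problem: on the code of a shuffled path it returns the code of
its vertex sequence, followed by blanks up to the length of the input. Nothing is required on other
input words. -/
def SolvesEdgeReordering (φ : List InSymbol → List OutSymbol) : Prop :=
  ∀ (l : ℕ) (p : List (Vertex l)) (es : List (Vertex l × Vertex l)), IsShuffledPath p es →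
    φ (encodeEdges es) =
      (encodeVertices p).rightpad (encodeEdges es).length OutSymbol.blank

end EdgeReordering

/-! To remove the start `a` of an edge `(a, b)` from the path, let the edge that ends in `a`, if
any, end in `b`. The other edges then form the path without `a`. Recursion sorts them, and `a` is
put back just before `b`: the edge `(c, b)` of the shorter path splits into `(c, a)` and `(a, b)`,
or `(a, b)` becomes the first edge when nothing ends in `b`. This is `reorder_eq`.

Both passes of the recursion run in parallel on a row of `2n` processors, one for each vertex
written in the input. Edges stream to the left; an edge that reaches the left end turns into a pivot
and travels right through all later edges, redirecting them (`Eliminating.step`). The pivots pile up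
in the order in which they must be reinserted, and then travel left into the growing sorted path by
compare-and-exchange (`Inserting.step`, `Inserting.pathOf_step`). `O(n)` steps suffice
(`reorder_procs`).

A processor is a block of `L = l + 1` cells, and one of its steps must take time `O(L)` although `L`
is unbounded and cells are finite. Cells wake up one after the other from the left, and cell `c`
counts time from its own awakening. In this local time data can move right at no cost, and left at
two units per cell. A head with period `2L` paces the steps while letters travel exactly one block
to either side (`IsDiagram.letter`). What a block decides as a whole, namely its tag and the
equality of registers, depends only on the set of letter triples occurring in it, a bounded amount
of data (`actionOf_cellTriple`). The head collects this set, which is available in the whole block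
one step later; `twoPhase` absorbs the delay. Altogether `O(n)` steps of `O(L)` units take time
linear in the input length. -/

namespace EdgeReordering

/-! ### Sorting the edges of a path by vertex elimination and reinsertion. -/

section Path

variable {V : Type} [DecidableEq V]

/-- Redirect the edge `f` to the end of `e` if `f` ends where `e` starts. -/
def redirect (e f : V × V) : V × V := (f.1, if f.2 = e.1 then e.2 else f.2)

/-- Insert the start of `e` into a path, given by its list of edges from last to first, immediately
before the end of `e`. -/
def insertEdge (e : V × V) : List (V × V) → List (V × V)
  | [] => [e]
  | f :: l => if f.2 = e.2 then e :: (f.1, e.1) :: l else f :: insertEdge e l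

/-- Eliminate the starts of the edges one after the other, then insert them again in the reverse
order. The result is the list of edges of the path, from last to first. -/
def reorder : List (V × V) → List (V × V)
  | [] => []
  | e :: l => insertEdge e (reorder (l.map (redirect e)))
termination_by l => l.length

theorem insertEdge_append_of_forall_ne (e : V × V) (l m : List (V × V))
    (h : ∀ f ∈ l, f.2 ≠ e.2) : insertEdge e (l ++ m) = l ++ insertEdge e m := by
  induction l with
  | nil => rfl
  | cons f l ih =>
    have h1 : f.2 ≠ e.2 := h f (by simp)
    simp only [List.cons_append, insertEdge, if_neg h1]
    rw [ih fun g hg => h g (by simp [hg])]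

theorem consecutiveEdges_append {V : Type} (l : List V) (x : V) (m : List V) :
    consecutiveEdges (l ++ x :: m) = consecutiveEdges (l ++ [x]) ++ consecutiveEdges (x :: m) := by
  induction l with
  | nil => simp [consecutiveEdges]
  | cons y l ih =>
    cases l with
    | nil => simp [consecutiveEdges]
    | cons z l => simpa [consecutiveEdges] using ih

theorem consecutiveEdges_cons_cons {V : Type} (x y : V) (l : List V) :
    consecutiveEdges (x :: y :: l) = (x, y) :: consecutiveEdges (y :: l) := rfl

theorem snd_mem_of_mem_consecutiveEdges {V : Type} {l : List V} {f : V × V}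
    (h : f ∈ consecutiveEdges l) : f.2 ∈ l.tail :=
  (List.of_mem_zip (a := f.1) (b := f.2) h).2

theorem exists_eq_append_of_mem_consecutiveEdges {V : Type} {p : List V} {e : V × V}
    (h : e ∈ consecutiveEdges p) : ∃ l m, p = l ++ e.1 :: e.2 :: m := by
  induction p with
  | nil => simp [consecutiveEdges] at h
  | cons x p ih =>
    cases p with
    | nil => simp [consecutiveEdges] at h
    | cons y p =>
      rw [consecutiveEdges_cons_cons, List.mem_cons] at h
      rcases h with rfl | h
      · exact ⟨[], p, rfl⟩
      · obtain ⟨l, m, hl⟩ := ih h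
        exact ⟨x :: l, m, by rw [hl]; rfl⟩

theorem map_redirect_of_forall_ne (e : V × V) (l : List (V × V)) (h : ∀ f ∈ l, f.2 ≠ e.1) :
    l.map (redirect e) = l := by
  conv_rhs => rw [← List.map_id l]
  exact List.map_congr_left fun f hf => by simp [redirect, h f hf]

/-- The witness `q` is `p` without the start `a` of `e`. If `a` is the first vertex, no edge is
redirected and the insertion runs to the end of the list, since no edge of `q` ends in `b`.
Otherwise only the edge from the predecessor `c` of `a` changes, and the insertion stops exactly
there, since the edges after it in the path end beyond `b`. -/
theorem eliminate_start {p : List V} (hp : p.Nodup) {e : V × V} {es : List (V × V)}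
    (h : (e :: es).Perm (consecutiveEdges p)) :
    ∃ q : List V, q.Nodup ∧ (es.map (redirect e)).Perm (consecutiveEdges q) ∧
      insertEdge e (consecutiveEdges q).reverse = (consecutiveEdges p).reverse := by
  obtain ⟨a, b⟩ := e
  obtain ⟨l, m, rfl⟩ := exists_eq_append_of_mem_consecutiveEdges
    (h.subset (List.mem_cons_self (a := (a, b)) (l := es)))
  simp only at hp h ⊢
  rcases List.eq_nil_or_concat l with rfl | ⟨l, c, rfl⟩
  · simp only [List.nil_append, consecutiveEdges_cons_cons] at h hp ⊢
    have hes := h.cons_inv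
    have ha : a ∉ m ∧ b ∉ m := by simp only [List.nodup_cons, List.mem_cons] at hp; tauto
    refine ⟨b :: m, hp.of_cons, ?_, ?_⟩
    · rw [map_redirect_of_forall_ne]
      · exact hes
      · intro f hf hfa
        have := snd_mem_of_mem_consecutiveEdges (hes.subset hf)
        simp only [hfa, List.tail_cons] at this
        exact ha.1 this
    · have := insertEdge_append_of_forall_ne (a, b) (consecutiveEdges (b :: m)).reverse [] (by
        intro f hf hfb
        have := snd_mem_of_mem_consecutiveEdges (List.mem_reverse.1 hf)
        simp only [hfb, List.tail_cons] at this
        exact ha.2 this)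
      simpa [insertEdge] using this
  · have e1 : consecutiveEdges (l ++ [c] ++ a :: b :: m) =
        consecutiveEdges (l ++ [c]) ++ (c, a) :: (a, b) :: consecutiveEdges (b :: m) := by
      rw [List.append_assoc, List.singleton_append, consecutiveEdges_append]
      simp [consecutiveEdges_cons_cons]
    have e2 : consecutiveEdges (l ++ c :: b :: m) =
        consecutiveEdges (l ++ [c]) ++ (c, b) :: consecutiveEdges (b :: m) := by
      rw [consecutiveEdges_append]; rfl
    simp only [List.concat_eq_append] at h hp ⊢
    rw [e1] at h ⊢
    have hes : es.Perm (consecutiveEdges (l ++ [c]) ++ (c, a) :: consecutiveEdges (b :: m)) := by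
      refine (h.trans ?_).cons_inv (a := (a, b))
      have := List.perm_middle (a := (a, b)) (l₁ := consecutiveEdges (l ++ [c]) ++ [(c, a)])
        (l₂ := consecutiveEdges (b :: m))
      simpa using this
    have hd : (a ∉ l ++ [c]) ∧ a ∉ b :: m ∧ b ∉ m := by
      rw [List.nodup_append'] at hp
      obtain ⟨-, h2, h3⟩ := hp
      simp only [List.nodup_cons] at h2
      exact ⟨fun hh => h3 hh (by simp), h2.1, h2.2.1⟩
    refine ⟨l ++ c :: b :: m, ?_, ?_, ?_⟩
    · refine hp.sublist ?_
      simp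
    · rw [e2]
      refine (hes.map (redirect (a, b))).trans (List.Perm.of_eq ?_)
      rw [List.map_append, List.map_cons, map_redirect_of_forall_ne, map_redirect_of_forall_ne]
      · simp [redirect]
      · intro f hf hfa
        have := List.mem_of_mem_tail (snd_mem_of_mem_consecutiveEdges hf)
        simp only [hfa] at this
        exact hd.2.1 this
      · intro f hf hfa
        have := List.mem_of_mem_tail (snd_mem_of_mem_consecutiveEdges hf)
        simp only [hfa] at this
        exact hd.1 this
    · rw [e2]
      simp only [List.reverse_append, List.reverse_cons, List.append_assoc, List.cons_append,
        List.nil_append]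
      rw [insertEdge_append_of_forall_ne]
      · simp [insertEdge]
      · intro f hf hfb
        have := snd_mem_of_mem_consecutiveEdges (List.mem_reverse.1 hf)
        simp only [hfb, List.tail_cons] at this
        exact hd.2.2 this

theorem reorder_eq {p : List V} {es : List (V × V)} (hp : p.Nodup)
    (h : es.Perm (consecutiveEdges p)) : reorder es = (consecutiveEdges p).reverse := by
  induction hk : es.length generalizing p es with
  | zero =>
    obtain rfl := List.length_eq_zero_iff.1 hk
    rw [List.nil_perm.1 h, reorder, List.reverse_nil]
  | succ k ih =>
    obtain _ | ⟨e, es⟩ := es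
    · simp at hk
    · obtain ⟨q, hq, hq1, hq2⟩ := eliminate_start hp h
      rw [reorder, ih hq hq1 (by simpa using hk), hq2]

end Path

/-! ### The local rule of the processors. -/

/-- The role of a processor: the first or second vertex of an edge of the input, an edge that is
still to be eliminated, the pivot of an elimination step, an edge of the reconstructed path, nothing,
or the last vertex of the path. -/
inductive Tag where
  | source | target | raw | pivot | settled | empty | last
  deriving DecidableEq

instance : Finite Tag :=
  Finite.of_injective (β := Fin 7)
    (fun | .source => 0 | .target => 1 | .raw => 2 | .pivot => 3 | .settled => 4 | .empty => 5 | .last => 6)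
    (by rintro (_ | _) (_ | _) h <;> first | rfl | simp at h)

/-- Whether a processor with this tag displays its first register. -/
def Tag.shown : Tag → Bool
  | .settled | .last => true
  | _ => false

/-- The register of a neighbouring or of the same processor. -/
inductive Side where
  | left | self | right

/-- A processor holds a tag and two registers. -/
structure Proc (V : Type) where
  tag : Tag
  fst : V
  snd : V

/-- The contents of a register, seen from a processor; `true` stands for the second register. -/
def fetch {V : Type} (l : Option (V × V)) (x : V × V) (r : Option (V × V)) (s : Side × Bool) : V :=
  let y := match s.1 with
    | .left => l.getD x
    | .self => x
    | .right => r.getD x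
  bif s.2 then y.2 else y.1

/-- The new tag of a processor and the registers that it copies, in terms of the tags of its
neighbours and itself, and of the outcome of three comparisons. -/
def action (l : Option Tag) (x : Tag) (r : Option Tag) (c₁ c₂ c₃ : Bool) :
    Tag × (Side × Bool) × (Side × Bool) :=
  match x with
  | .source => (.raw, (.self, false), (.right, false))
  | .target => (.empty, (.self, false), (.self, true))
  | .raw => match l with
    | none => (.pivot, (.self, false), (.self, true))
    | some .pivot => (.pivot, (.left, false), (.left, true))
    | some _ => (.empty, (.self, false), (.self, true))
  | .pivot => match r with
    | some .raw => bif c₁ then (.raw, (.right, false), (.self, true))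
        else (.raw, (.right, false), (.right, true))
    | _ => match l with
      | none => (.settled, (.self, false), (.self, true))
      | some .settled => bif c₂ then (.settled, (.self, false), (.self, true))
        else (.settled, (.left, false), (.left, true))
      | some _ => (.pivot, (.self, false), (.self, true))
  | .settled => match r with
    | some .pivot => bif c₃ then (.settled, (.self, false), (.right, false))
        else (.pivot, (.right, false), (.right, true))
    | _ => (.settled, (.self, false), (.self, true))
  | .empty | .last => match r with
    | some .raw => (.raw, (.right, false), (.right, true))
    | _ => match l with
      | some .settled => (.last, (.left, true), (.left, true))
      | _ => (.empty, (.self, false), (.self, true))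

namespace Proc

variable {V : Type}

/-- The two registers of a processor. -/
def regs (x : Proc V) : V × V := (x.fst, x.snd)

open Classical in
/-- The action taken by a processor. -/
noncomputable def act (l : Option (Proc V)) (x : Proc V) (r : Option (Proc V)) :
    Tag × (Side × Bool) × (Side × Bool) :=
  action (l.map tag) x.tag (r.map tag) (decide (∀ y ∈ r, y.snd = x.fst))
    (decide (∀ y ∈ l, y.snd = x.snd)) (decide (∀ y ∈ r, x.snd = y.snd))

/-- The new state of a processor. -/
noncomputable def next (l : Option (Proc V)) (x : Proc V) (r : Option (Proc V)) : Proc V where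
  tag := (act l x r).1
  fst := fetch (l.map regs) x.regs (r.map regs) (act l x r).2.1
  snd := fetch (l.map regs) x.regs (r.map regs) (act l x r).2.2

theorem next_source (l : Option (Proc V)) (u v u' v' : V) (t : Tag) :
    next l ⟨.source, u, v⟩ (some ⟨t, u', v'⟩) = ⟨.raw, u, u'⟩ := by
  simp [next, act, action, fetch, regs]

theorem next_target_tag (l r : Option (Proc V)) (x : Proc V) (hx : x.tag = .target) :
    (next l x r).tag = .empty := by
  simp [next, act, action, hx]

theorem next_raw_none (u v : V) (r : Option (Proc V)) :
    next none ⟨.raw, u, v⟩ r = ⟨.pivot, u, v⟩ := by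
  simp [next, act, action, fetch, regs]

/-- Together with `next_pivot_raw`: a pivot and the raw edge to its right exchange places, and the
raw edge is redirected in passing. -/
theorem next_raw_pivot (u v u' v' : V) (r : Option (Proc V)) :
    next (some ⟨.pivot, u', v'⟩) ⟨.raw, u, v⟩ r = ⟨.pivot, u', v'⟩ := by
  simp [next, act, action, fetch, regs]

theorem next_raw_empty (y : Proc V) (hy : y.tag = .empty) (u v : V) (r : Option (Proc V)) :
    (next (some y) ⟨.raw, u, v⟩ r).tag = .empty := by
  simp [next, act, action, hy]

theorem next_pivot_raw [DecidableEq V] (l : Option (Proc V)) (p q u v : V) :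
    next l ⟨.pivot, p, q⟩ (some ⟨.raw, u, v⟩) = ⟨.raw, u, if v = p then q else v⟩ := by
  by_cases h : v = p <;> simp [next, act, action, fetch, regs, h]

theorem next_empty_raw (l : Option (Proc V)) (x : Proc V) (hx : x.tag = .empty) (u v : V) :
    next l x (some ⟨.raw, u, v⟩) = ⟨.raw, u, v⟩ := by
  simp [next, act, action, fetch, regs, hx]

theorem next_pivot_of_left (y : Proc V) (hy : y.tag ≠ .settled) (p q : V) (r : Option (Proc V))
    (hr : ∀ z ∈ r, z.tag ≠ .raw) :
    next (some y) ⟨.pivot, p, q⟩ r = ⟨.pivot, p, q⟩ := by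
  obtain ⟨t, u, v⟩ := y
  rcases r with _ | ⟨t', u', v'⟩
  · cases t <;> simp_all [next, act, action, fetch, regs]
  · cases t <;> cases t' <;> simp_all [next, act, action, fetch, regs]

theorem next_empty_tag (l : Option (Proc V)) (x : Proc V) (hx : x.tag = .empty ∨ x.tag = .last)
    (r : Option (Proc V)) (hl : ∀ z ∈ l, z.tag ≠ .settled) (hr : ∀ z ∈ r, z.tag ≠ .raw) :
    (next l x r).tag = .empty := by
  rcases r with _ | ⟨t', u', v'⟩ <;> rcases l with _ | ⟨t, u, v⟩ <;>
    try cases t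
  all_goals try cases t'
  all_goals rcases hx with hx | hx <;> simp_all [next, act, action]

theorem next_pivot_none (p q : V) (r : Option (Proc V)) (hr : ∀ z ∈ r, z.tag ≠ .raw) :
    next none ⟨.pivot, p, q⟩ r = ⟨.settled, p, q⟩ := by
  rcases r with _ | ⟨t', u', v'⟩
  · simp [next, act, action, fetch, regs]
  · cases t' <;> simp_all [next, act, action, fetch, regs]

/-- Together with `next_settled_pivot`, this carries out one recursive call of `insertEdge` on two
adjacent processors: either the pivot splits the settled edge, or the two exchange places. -/
theorem next_pivot_settled [DecidableEq V] (u v p q : V) (r : Option (Proc V))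
    (hr : ∀ z ∈ r, z.tag ≠ .raw) :
    next (some ⟨.settled, u, v⟩) ⟨.pivot, p, q⟩ r =
      if v = q then ⟨.settled, p, q⟩ else ⟨.settled, u, v⟩ := by
  rcases r with _ | ⟨t', u', v'⟩
  · by_cases h : v = q <;> simp [next, act, action, fetch, regs, h]
  · by_cases h : v = q <;> cases t' <;> simp_all [next, act, action, fetch, regs]

theorem next_settled_pivot [DecidableEq V] (l : Option (Proc V)) (u v p q : V) :
    next l ⟨.settled, u, v⟩ (some ⟨.pivot, p, q⟩) =
      if v = q then ⟨.settled, u, p⟩ else ⟨.pivot, p, q⟩ := by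
  by_cases h : v = q <;> simp [next, act, action, fetch, regs, h]

theorem next_settled (l : Option (Proc V)) (u v : V) (r : Option (Proc V))
    (hr : ∀ z ∈ r, z.tag ≠ .pivot) :
    next l ⟨.settled, u, v⟩ r = ⟨.settled, u, v⟩ := by
  rcases r with _ | ⟨t', u', v'⟩
  · simp [next, act, action, fetch, regs]
  · cases t' <;> simp_all [next, act, action, fetch, regs]

theorem next_empty_settled (x : Proc V) (hx : x.tag = .empty ∨ x.tag = .last) (u v : V)
    (r : Option (Proc V)) (hr : ∀ z ∈ r, z.tag ≠ .raw) :
    next (some ⟨.settled, u, v⟩) x r = ⟨.last, v, v⟩ := by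
  rcases r with _ | ⟨t', u', v'⟩
  · rcases hx with hx | hx <;> simp [next, act, action, fetch, regs, hx]
  · rcases hx with hx | hx <;> cases t' <;> simp_all [next, act, action, fetch, regs]

/-- One synchronous step of a row of `N` processors. -/
noncomputable def step (N : ℕ) (c : ℕ → Proc V) (x : ℕ) : Proc V :=
  next (if 1 ≤ x then some (c (x - 1)) else none) (c x) (if x + 1 < N then some (c (x + 1)) else none)

theorem step_zero (N : ℕ) (c : ℕ → Proc V) :
    step N c 0 = next none (c 0) (if 0 + 1 < N then some (c (0 + 1)) else none) := by
  simp [step]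

theorem step_succ (N : ℕ) (c : ℕ → Proc V) (x : ℕ) :
    step N c (x + 1) =
      next (some (c x)) (c (x + 1)) (if x + 1 + 1 < N then some (c (x + 1 + 1)) else none) := by
  simp [step]

end Proc

/-! ### The elimination pass: raw edges move left, pivots move right. -/

section Elimination

variable {V : Type} [DecidableEq V] (a b : ℕ → V)

/-- The end of the `j`-th edge after the elimination of the starts of the first `i` edges. -/
def redirected : ℕ → ℕ → V
  | 0, j => b j
  | i + 1, j => if redirected i j = a i then redirected i i else redirected i j

/-- The `i`-th edge at the time of the elimination of its start. -/
def pivotProc (i : ℕ) : Proc V := ⟨.pivot, a i, redirected a b i i⟩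

/-- The state of the row of processors after `s` steps of the elimination of the `n` edges. -/
structure Eliminating (n s : ℕ) (c : ℕ → Proc V) : Prop where
  raw : ∀ x, x + s + 2 ≤ 2 * n → x % 2 = s % 2 →
    c x = ⟨.raw, a ((x + s) / 2), redirected a b (s - (x + s) / 2) ((x + s) / 2)⟩
  moving : ∀ x, x + s + 2 ≤ 2 * n → x % 2 ≠ s % 2 → x < s → c x = pivotProc a b ((s - 1 - x) / 2)
  gap : ∀ x, x + s + 2 ≤ 2 * n → x % 2 ≠ s % 2 → s < x → (c x).tag = .empty
  stopped : ∀ x, 2 * n ≤ x + s + 1 → x < n → c x = pivotProc a b (n - 1 - x)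
  empty : ∀ x, 2 * n ≤ x + s + 1 → n ≤ x → x < 2 * n → (c x).tag = .empty

variable {a b}

theorem Eliminating.tag {n s : ℕ} {c : ℕ → Proc V} (h : Eliminating a b n s c) {x : ℕ}
    (hx : x < 2 * n) : (c x).tag ≠ .settled := by
  by_cases h1 : x + s + 2 ≤ 2 * n
  · by_cases h2 : x % 2 = s % 2
    · simp [h.raw x h1 h2]
    · rcases lt_or_gt_of_ne (show x ≠ s by rintro rfl; exact h2 rfl) with h3 | h3
      · simp [h.moving x h1 h2 h3, pivotProc]
      · simp [h.gap x h1 h2 h3]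
  · by_cases h2 : x < n
    · simp [h.stopped x (by omega) h2, pivotProc]
    · simp [h.empty x (by omega) (by omega) hx]

theorem Eliminating.not_raw {n s : ℕ} {c : ℕ → Proc V} (h : Eliminating a b n s c) {x : ℕ}
    (hs : 2 * n ≤ x + s + 1) : ∀ z ∈ (if x < 2 * n then some (c x) else none), z.tag ≠ .raw := by
  intro z hz
  split_ifs at hz with h1
  · simp only [Option.mem_def, Option.some.injEq] at hz
    subst hz
    by_cases h2 : x < n
    · simp [h.stopped x hs h2, pivotProc]
    · simp [h.empty x hs (by omega) h1]
  · simp at hz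

/-- The trajectories explain the invariant. At time `s` the raw edge `j` is at `2 * j - s`, and the
moving pivot `i` is at `s - 1 - 2 * i`. Pivot `i` meets the last raw edge on arriving at `n - 1 - i`
and stays there. -/
theorem Eliminating.step {n s : ℕ} {c : ℕ → Proc V} (h : Eliminating a b n s c)
    (hs : s + 2 ≤ 2 * n) : Eliminating a b n (s + 1) (Proc.step (2 * n) c) where
  raw x hx hp := by
    have h1 := h.raw (x + 1) (by omega) (by omega)
    rw [Proc.step, if_pos (show x + 1 < 2 * n by omega), h1]
    have e1 : (x + (s + 1)) / 2 = (x + 1 + s) / 2 := by omega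
    rcases lt_or_gt_of_ne (show x ≠ s by omega) with h3 | h3
    · rw [h.moving x (by omega) (by omega) h3, pivotProc, Proc.next_pivot_raw]
      have e2 : s + 1 - (x + 1 + s) / 2 = s - (x + 1 + s) / 2 + 1 := by omega
      -- The index of the pivot met is the number of pivots the edge has already passed, so
      -- `redirected` advances by exactly one stage.
      have e3 : (s - 1 - x) / 2 = s - (x + 1 + s) / 2 := by omega
      rw [e1, e2, e3, redirected]
    · rw [Proc.next_empty_raw _ _ (h.gap x (by omega) (by omega) h3), e1]
      -- Both truncated differences are zero: this edge has not met a pivot yet.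
      have e2 : s + 1 - (x + 1 + s) / 2 = s - (x + 1 + s) / 2 := by omega
      rw [e2]
  moving x hx hp hxs := by
    have h1 := h.raw x (by omega) (by omega)
    rcases x with _ | x
    · rw [Proc.step_zero, h1, Proc.next_raw_none, pivotProc]
      have e1 : (0 + s) / 2 = (s + 1 - 1 - 0) / 2 := by omega
      have e2 : s - (s + 1 - 1 - 0) / 2 = (s + 1 - 1 - 0) / 2 := by omega
      rw [e1, e2]
    · rw [Proc.step_succ, h1, h.moving x (by omega) (by omega) (by omega), pivotProc,
        Proc.next_raw_pivot, pivotProc]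
      have e1 : (s - 1 - x) / 2 = (s + 1 - 1 - (x + 1)) / 2 := by omega
      rw [e1]
  gap x hx hp hxs := by
    have h1 := h.raw x (by omega) (by omega)
    rcases x with _ | x
    · omega
    · rw [Proc.step_succ, h1]
      exact Proc.next_raw_empty _ (h.gap x (by omega) (by omega) (by omega)) _ _ _
  stopped x hx hxn := by
    by_cases h0 : 2 * n ≤ x + s + 1
    · rcases x with _ | x
      · omega
      · rw [Proc.step_succ, h.stopped _ h0 hxn, pivotProc, Proc.next_pivot_of_left _ (h.tag (by omega))]
        exact h.not_raw (by omega)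
    · have h1 := h.raw x (by omega) (by omega)
      rcases x with _ | x
      · rw [Proc.step_zero, h1, Proc.next_raw_none, pivotProc]
        have e1 : (0 + s) / 2 = n - 1 - 0 := by omega
        have e2 : s - (n - 1 - 0) = n - 1 - 0 := by omega
        rw [e1, e2]
      · rw [Proc.step_succ, h1, h.moving x (by omega) (by omega) (by omega), pivotProc,
          Proc.next_raw_pivot, pivotProc]
        have e1 : (s - 1 - x) / 2 = n - 1 - (x + 1) := by omega
        rw [e1]
  empty x hx hnx hxn := by
    rcases x with _ | x
    · omega
    rw [Proc.step_succ]
    by_cases h0 : 2 * n ≤ x + 1 + s + 1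
    · refine Proc.next_empty_tag _ _ (Or.inl (h.empty _ h0 hnx hxn)) _ ?_ (h.not_raw (by omega))
      intro z hz
      simp only [Option.mem_def, Option.some.injEq] at hz
      exact hz ▸ h.tag (by omega)
    · rw [h.raw (x + 1) (by omega) (by omega)]
      exact Proc.next_raw_empty _ (h.gap x (by omega) (by omega) (by omega)) _ _ _

theorem Eliminating.iterate {n : ℕ} {c : ℕ → Proc V} (h : Eliminating a b n 0 c) {s : ℕ}
    (hs : s + 1 ≤ 2 * n) : Eliminating a b n s ((Proc.step (2 * n))^[s] c) := by
  induction s with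
  | zero => exact h
  | succ s ih =>
    rw [Function.iterate_succ_apply']
    exact (ih (by omega)).step (by omega)

end Elimination

/-! ### The insertion pass: pivots move left into the sorted path. -/

section Insertion

variable {V : Type} [DecidableEq V]

/-- The list, from last to first, of the edges of the path that results from the insertion of the
pivots among the first `m` processors. -/
def pathOf (c : ℕ → Proc V) : ℕ → List (V × V)
  | 0 => []
  | m + 1 => if (c m).tag = .pivot then insertEdge (c m).regs (pathOf c m)
      else (c m).regs :: pathOf c m

/-- The state of the row of processors after `s` steps of the insertion of `n` pivots. -/
structure Inserting (n s : ℕ) (l : List (V × V)) (c : ℕ → Proc V) : Prop where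
  waiting : ∀ x, x < n → s ≤ x → (c x).tag = .pivot
  tag : ∀ x, x < n → (c x).tag = .pivot ∨ (c x).tag = .settled
  empty : ∀ x, n ≤ x → x < 2 * n → (c x).tag = .empty ∨ (c x).tag = .last
  moving : ∀ x, x < n → x ≤ s → (c x).tag = .pivot → x % 2 = s % 2 ∧ x + s + 2 ≤ 2 * n
  path : pathOf c n = l

namespace Inserting

variable {n s : ℕ} {l : List (V × V)} {c : ℕ → Proc V}

theorem not_raw (h : Inserting n s l c) (x : ℕ) :
    ∀ z ∈ (if x < 2 * n then some (c x) else none), z.tag ≠ .raw := by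
  intro z hz
  split_ifs at hz with h1
  · simp only [Option.mem_def, Option.some.injEq] at hz
    subst hz
    by_cases h2 : x < n
    · rcases h.tag x h2 with h3 | h3 <;> simp [h3]
    · rcases h.empty x (by omega) h1 with h3 | h3 <;> simp [h3]
  · simp at hz

theorem not_pivot (h : Inserting n s l c) (x : ℕ) (hx : x < n → (c x).tag ≠ .pivot) :
    ∀ z ∈ (if x < 2 * n then some (c x) else none), z.tag ≠ .pivot := by
  intro z hz
  split_ifs at hz with h1
  · simp only [Option.mem_def, Option.some.injEq] at hz
    subst hz
    by_cases h2 : x < n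
    · exact hx h2
    · rcases h.empty x (by omega) h1 with h3 | h3 <;> simp [h3]
  · simp at hz

theorem step_of_settled (h : Inserting n s l c) {x : ℕ} (hc : (c x).tag = .settled)
    (hr : x + 1 < n → (c (x + 1)).tag ≠ .pivot) : Proc.step (2 * n) c x = c x := by
  rw [Proc.step]
  have := h.not_pivot (x + 1) hr
  rcases hcx : c x with ⟨t, u, v⟩
  rw [hcx] at hc
  simp only at hc
  subst hc
  exact Proc.next_settled _ _ _ _ this

theorem step_of_pivot_pivot (h : Inserting n s l c) {x : ℕ}
    (hc : (c (x + 1)).tag = .pivot) (hl : (c x).tag = .pivot) :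
    Proc.step (2 * n) c (x + 1) = c (x + 1) := by
  rw [Proc.step_succ]
  rcases hcx : c (x + 1) with ⟨t, u, v⟩
  rw [hcx] at hc
  simp only at hc
  subst hc
  exact Proc.next_pivot_of_left _ (by simp [hl]) _ _ _ (h.not_raw _)

theorem step_of_settled_pivot (h : Inserting n s l c) {x : ℕ} (hx : x + 1 < n)
    (hc : (c (x + 1)).tag = .pivot) (hl : (c x).tag = .settled) :
    ∃ u v p q, c x = ⟨.settled, u, v⟩ ∧ c (x + 1) = ⟨.pivot, p, q⟩ ∧
      (Proc.step (2 * n) c x = if v = q then ⟨.settled, u, p⟩ else ⟨.pivot, p, q⟩) ∧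
      (Proc.step (2 * n) c (x + 1) = if v = q then ⟨.settled, p, q⟩ else ⟨.settled, u, v⟩) := by
  rcases hcx : c (x + 1) with ⟨t, p, q⟩
  rcases hcl : c x with ⟨t', u, v⟩
  rw [hcx] at hc
  rw [hcl] at hl
  simp only at hc hl
  subst hc hl
  refine ⟨u, v, p, q, rfl, rfl, ?_, ?_⟩
  · rw [Proc.step, if_pos (show x + 1 < 2 * n by omega), hcx, hcl, Proc.next_settled_pivot]
  · rw [Proc.step_succ, hcx, hcl, Proc.next_pivot_settled _ _ _ _ _ (h.not_raw _)]

theorem step_zero (h : Inserting n s l c) (hc : (c 0).tag = .pivot) :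
    Proc.step (2 * n) c 0 = ⟨.settled, (c 0).fst, (c 0).snd⟩ := by
  rw [Proc.step_zero]
  rcases hcx : c 0 with ⟨t, u, v⟩
  rw [hcx] at hc
  simp only at hc
  subst hc
  exact Proc.next_pivot_none _ _ _ (h.not_raw _)

/-- Each exchange merely unfolds `insertEdge` once, so the final path, with all pending insertions
carried out, is conserved. The hypothesis `hb` keeps the prefix from being cut between a settled
edge and the pivot acting on it. -/
theorem pathOf_step (h : Inserting n s l c) (m : ℕ) (hm : m ≤ n)
    (hb : m < n → (c m).tag = .pivot → 0 < m → (c (m - 1)).tag = .pivot) :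
    pathOf (Proc.step (2 * n) c) m = pathOf c m := by
  induction m using Nat.strong_induction_on with
  | _ m ih =>
    rcases m with _ | m
    · rfl
    · simp only [Nat.add_sub_cancel] at hb
      rcases h.tag m (by omega) with hc | hc
      · rcases m with _ | m
        · simp [pathOf, h.step_zero hc, hc, insertEdge, Proc.regs]
        · rcases h.tag m (by omega) with hl | hl
          · rw [pathOf.eq_2 _ (m + 1), pathOf.eq_2 c (m + 1), h.step_of_pivot_pivot hc hl,
              ih (m + 1) (by omega) (by omega) (by simp [hl])]
          -- An interacting pair is peeled off as a whole; this is why the induction is strong.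
          · obtain ⟨u, v, p, q, e1, e2, e3, e4⟩ := h.step_of_settled_pivot (by omega) hc hl
            rw [pathOf, pathOf, pathOf, pathOf, e1, e2, e3, e4, ih m (by omega) (by omega)
              (by simp [hl])]
            by_cases hvq : v = q <;> simp [hvq, insertEdge, Proc.regs]
      · rw [pathOf, pathOf, h.step_of_settled hc ?_, ih m (by omega) (by omega) (by simp [hc])]
        intro h1 h2
        simpa [hc] using hb h1 h2

/-- The pivot waiting at `y` starts at time `y` and then moves left at speed 1, so position plus
time stays `2 * y ≤ 2 * n - 2` until it settles. The field `moving` records the parity and the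
bound; the parity keeps moving pivots from being adjacent. -/
theorem step (h : Inserting n s l c) : Inserting n (s + 1) l (Proc.step (2 * n) c) where
  waiting x hx hsx := by
    rcases x with _ | x
    · omega
    · rw [h.step_of_pivot_pivot (h.waiting _ hx (by omega)) (h.waiting _ (by omega) (by omega))]
      exact h.waiting _ hx (by omega)
  tag x hx := by
    rcases h.tag x hx with hc | hc
    · rcases x with _ | x
      · simp [h.step_zero hc]
      · rcases h.tag x (by omega) with hl | hl
        · simp [h.step_of_pivot_pivot hc hl, hc]
        · obtain ⟨u, v, p, q, -, -, -, e4⟩ := h.step_of_settled_pivot (by omega) hc hl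
          rw [e4]; split_ifs <;> simp
    · by_cases hr : x + 1 < n ∧ (c (x + 1)).tag = .pivot
      · obtain ⟨u, v, p, q, -, -, e3, -⟩ := h.step_of_settled_pivot hr.1 hr.2 hc
        rw [e3]; split_ifs <;> simp
      · rw [h.step_of_settled hc (fun h1 h2 => hr ⟨h1, h2⟩)]
        exact Or.inr hc
  empty x hx hxn := by
    have hr := h.not_raw (x + 1)
    rcases x with _ | x
    · omega
    rw [Proc.step_succ]
    rcases hcx : c x with ⟨t, u, v⟩
    by_cases ht : t = .settled
    · subst ht
      rw [Proc.next_empty_settled _ (h.empty _ hx hxn) _ _ _ hr]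
      simp
    · refine Or.inl (Proc.next_empty_tag _ _ (h.empty _ hx hxn) _ (by simpa using ht) hr)
  moving x hx hxs hc := by
    rcases h.tag x hx with hc' | hc'
    · rcases x with _ | x
      · simp [h.step_zero hc'] at hc
      · rcases h.tag x (by omega) with hl | hl
        · by_cases h1 : x + 1 ≤ s
          · have := h.moving _ hx h1 hc'
            have := h.moving x (by omega) (by omega) hl
            omega
          · omega
        · obtain ⟨u, v, p, q, -, -, -, e4⟩ := h.step_of_settled_pivot (by omega) hc' hl
          rw [e4] at hc; split_ifs at hc
    · by_cases hr : x + 1 < n ∧ (c (x + 1)).tag = .pivot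
      · have h1 : x < s := by
          by_contra h1
          simpa [hc'] using h.waiting x hx (by omega)
        have := h.moving _ hr.1 (by omega) hr.2
        omega
      · rw [h.step_of_settled hc' (fun h1 h2 => hr ⟨h1, h2⟩), hc'] at hc
        simp at hc
  path := by rw [h.pathOf_step n le_rfl (by omega), h.path]

theorem iterate (h : Inserting n s l c) (k : ℕ) :
    Inserting n (s + k) l ((Proc.step (2 * n))^[k] c) := by
  induction k with
  | zero => exact h
  | succ k ih =>
    rw [Function.iterate_succ_apply']
    exact ih.step

theorem settled (h : Inserting n s l c) (hs : 2 * n ≤ s + 1) {x : ℕ} (hx : x < n) :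
    (c x).tag = .settled := by
  rcases h.tag x hx with hc | hc
  · have := h.moving x hx (by omega) hc
    omega
  · exact hc

theorem last (h : Inserting n s l c) (hs : 2 * n ≤ s + 1) (hn : 0 < n) :
    Proc.step (2 * n) c n = ⟨.last, (c (n - 1)).snd, (c (n - 1)).snd⟩ := by
  obtain ⟨m, rfl⟩ : ∃ m, n = m + 1 := ⟨n - 1, by omega⟩
  have h1 := h.settled hs (show m < m + 1 by omega)
  rw [Proc.step_succ, Nat.add_sub_cancel]
  rcases hcx : c m with ⟨t, u, v⟩
  rw [hcx] at h1
  simp only at h1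
  subst h1
  exact Proc.next_empty_settled _ (h.empty _ le_rfl (by omega)) _ _ _ (h.not_raw _)

theorem empty_of_lt (h : Inserting n s l c) {x : ℕ} (hx : n < x) (hxn : x < 2 * n) :
    (Proc.step (2 * n) c x).tag = .empty := by
  rcases x with _ | x
  · omega
  rw [Proc.step_succ]
  refine Proc.next_empty_tag _ _ (h.empty _ (by omega) hxn) _ ?_ (h.not_raw _)
  intro z hz
  simp only [Option.mem_def, Option.some.injEq] at hz
  subst hz
  rcases h.empty x (by omega) (by omega) with h1 | h1 <;> simp [h1]

theorem getElem_of_settled (m : ℕ) (hm : ∀ x < m, (c x).tag = .settled) :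
    pathOf c m = ((List.range m).map fun x => (c x).regs).reverse := by
  induction m with
  | zero => rfl
  | succ m ih =>
    rw [pathOf, hm m (by omega), if_neg (by simp), ih fun x hx => hm x (by omega)]
    simp [List.range_succ]

end Inserting

/-- The pile of pivots is the recursion stack of `reorder`: the last eliminated edge lies at
processor 0 and is inserted first. -/
theorem pathOf_pivots (a b : ℕ → V) (n : ℕ) {c : ℕ → Proc V}
    (hc : ∀ x < n, c x = pivotProc a b (n - 1 - x)) (m : ℕ) (hm : m ≤ n) :
    pathOf c m = reorder ((List.range' (n - m) m).map fun j => (a j, redirected a b (n - m) j)) := by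
  induction m with
  | zero => simp [pathOf, reorder]
  | succ m ih =>
    have e1 : n - 1 - m = n - (m + 1) := by omega
    have e2 : n - m = n - (m + 1) + 1 := by omega
    rw [pathOf, hc m (by omega), ih (by omega), List.range'_succ, List.map_cons, reorder, e1, e2,
      List.map_map]
    rfl

/-- Rows of processors reorder the edges of a path. -/
theorem reorder_procs {p : List V} (hp : p.Nodup) {n : ℕ} (hn : 0 < n) (a b : ℕ → V)
    (h : ((List.range n).map fun j => (a j, b j)).Perm (consecutiveEdges p)) {c : ℕ → Proc V}
    (ha : ∀ j < n, (c (2 * j)).tag = .source ∧ (c (2 * j)).fst = a j)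
    (hb : ∀ j < n, (c (2 * j + 1)).tag = .target ∧ (c (2 * j + 1)).fst = b j) (r : ℕ)
    (hr : 6 * n ≤ r) :
    (∀ x, x ≤ n → ((Proc.step (2 * n))^[r] c x).tag.shown = true ∧
      p[x]? = some ((Proc.step (2 * n))^[r] c x).fst) ∧
    ∀ x, n < x → x < 2 * n → ((Proc.step (2 * n))^[r] c x).tag = .empty := by
  have h0 : Eliminating a b n 0 (Proc.step (2 * n) c) := by
    have hraw : ∀ j < n, Proc.step (2 * n) c (2 * j) = ⟨.raw, a j, b j⟩ := by
      intro j hj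
      rw [Proc.step, if_pos (show 2 * j + 1 < 2 * n by omega)]
      rcases hcx : c (2 * j) with ⟨t, u, v⟩
      rcases hcy : c (2 * j + 1) with ⟨t', u', v'⟩
      have h1 := ha j hj
      have h2 := hb j hj
      simp only [hcx, hcy] at h1 h2
      rw [h1.1, h1.2, h2.2, Proc.next_source]
    have hemp : ∀ j < n, (Proc.step (2 * n) c (2 * j + 1)).tag = .empty := fun j hj =>
      Proc.next_target_tag _ _ _ (hb j hj).1
    constructor
    · intro x h1 h2
      obtain ⟨j, rfl⟩ : ∃ j, x = 2 * j := ⟨x / 2, by omega⟩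
      have e1 : (2 * j + 0) / 2 = j := by omega
      rw [hraw j (by omega), e1, Nat.zero_sub, redirected]
    · intro x _ _ h1
      omega
    · intro x h1 h2 _
      obtain ⟨j, rfl⟩ : ∃ j, x = 2 * j + 1 := ⟨x / 2, by omega⟩
      exact hemp j (by omega)
    · intro x h1 h2
      omega
    · intro x h1 _ h2
      obtain ⟨j, rfl⟩ : ∃ j, x = 2 * j + 1 := ⟨x / 2, by omega⟩
      exact hemp j (by omega)
  have h1 := h0.iterate (s := 2 * n - 1) (by omega)
  -- One step joins the two vertices of each edge in one processor; `2 * n - 1` steps of elimination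
  -- follow.
  rw [← Function.iterate_succ_apply, show (2 * n - 1).succ = 2 * n by omega] at h1
  set c' := (Proc.step (2 * n))^[2 * n] c with hc'
  have h2 : Inserting n 0 (consecutiveEdges p).reverse c' := by
    have hst : ∀ x < n, c' x = pivotProc a b (n - 1 - x) := fun x hx => h1.stopped x (by omega) hx
    constructor
    · intro x hx _
      rw [hst x hx]; rfl
    · intro x hx
      rw [hst x hx]; exact Or.inl rfl
    · intro x hx hxn
      exact Or.inl (h1.empty x (by omega) hx hxn)
    · intro x hx hx0 _
      omega
    · rw [pathOf_pivots a b n hst n le_rfl, ← reorder_eq hp h]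
      simp [redirected, List.range_eq_range']
  -- After `k` steps of insertion all edges are settled, since `k ≥ 2 * n - 1`. One further step
  -- ensures that processor `n` holds the last vertex and that those to its right are empty.
  obtain ⟨k, rfl⟩ : ∃ k, r = (k + 1) + 2 * n := ⟨r - 1 - 2 * n, by omega⟩
  rw [Function.iterate_add_apply, ← hc']
  have h3 := h2.iterate k
  have h4 := h2.iterate (k + 1)
  rw [zero_add] at h3 h4
  have h5 := Inserting.getElem_of_settled n fun x hx => h3.settled (by omega) hx
  rw [h3.path, List.reverse_inj] at h5
  have h6 := Inserting.getElem_of_settled n fun x hx => h4.settled (by omega) hx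
  rw [h4.path, List.reverse_inj] at h6
  have hzip : ∀ x y, (consecutiveEdges p)[x]? = some y → p[x]? = some y.1 ∧ p[x + 1]? = some y.2 := by
    intro x y hy
    rw [consecutiveEdges, List.getElem?_zip_eq_some, List.getElem?_tail] at hy
    exact hy
  refine ⟨fun x hx => ?_, fun x hx hxn => ?_⟩
  · rcases hx.eq_or_lt with rfl | hx
    · rw [Function.iterate_succ_apply', h3.last (by omega) hn]
      have := (hzip (x - 1) ((Proc.step (2 * x))^[k] c' (x - 1)).regs (by
        rw [h5]
        simp [hn])).2
      rw [show x - 1 + 1 = x by omega] at this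
      exact ⟨rfl, this⟩
    · have := (hzip x ((Proc.step (2 * n))^[k + 1] c' x).regs (by
        rw [h6]
        simp [hx])).1
      exact ⟨by rw [h4.settled (by omega) hx]; rfl, this⟩
  · rw [Function.iterate_succ_apply']
    exact h3.empty_of_lt hx hxn

end Insertion

/-! ### Synchronizing blocks of unbounded length in skewed local time. -/

/-- The letters at the same place of three consecutive blocks, where the outer ones may be absent. -/
abbrev Triple (G : Type) : Type := Option G × G × Option G

section Blocks

variable {G : Type}

/-- The letter at place `c` of a row of length `N` and the letters at distance `L` from it. -/
def triple (N L : ℕ) (z : ℕ → G) (c : ℕ) : Triple G :=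
  (if L ≤ c then some (z (c - L)) else none, z c, if c + L < N then some (z (c + L)) else none)

/-- The set of the triples in the `j`-th block. -/
def blockTriples (N L : ℕ) (z : ℕ → G) (j : ℕ) : Set (Triple G) :=
  {t | ∃ c < N, c / L = j ∧ t = triple N L z c}

/-- A step of a row of blocks of length `L`. A configuration consists of the letters and of a set of
triples for each block. The new letters depend on the triples of letters and on the set that belongs
to the block; the new sets are the sets of triples. -/
def blockStep (h : Set (Triple G) → Triple G → G) (N L : ℕ)
    (y : (ℕ → G) × (ℕ → Set (Triple G))) : (ℕ → G) × (ℕ → Set (Triple G)) :=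
  (fun c => h (y.2 (c / L)) (triple N L y.1 c), blockTriples N L y.1)

/-- The contents of a cell of the automaton that simulates a row of blocks: the letter, a mark on the
last cell of a block, the head that starts a step and moves right, the signal that moves left
and brings back the head, a letter moving right at speed 1/3 and a letter moving left at speed 1,
the triples met by the head in this block, and the set of triples of the previous step. -/
structure Core (G : Type) where
  letter : G
  isEnd : Bool
  head : Bool
  back : Bool
  back' : Bool
  right₁ : Option G
  right₂ : Option G
  right₃ : Option G
  left : Option G
  met : Set (Triple G)
  known : Set (Triple G)

namespace Core

instance [Finite G] : Finite (Core G) :=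
  Finite.of_injective
    (fun k : Core G => (k.letter, (k.isEnd, k.head, k.back, k.back'),
      (k.right₁, k.right₂, k.right₃, k.left), k.met, k.known))
    (by rintro ⟨⟩ ⟨⟩ h; simp only [Prod.mk.injEq] at h; simp [h])

/-- A cell at its first activity. -/
def start (x : G) (e : Bool) : Core G where
  letter := x
  isEnd := e
  head := true
  back := e
  back' := false
  right₁ := some x
  right₂ := none
  right₃ := none
  left := some x
  met := ∅
  known := ∅

variable (h : Set (Triple G) → Triple G → G)

/-- The triple of letters present in a cell. -/
def incoming (l : Option (Core G)) (k : Core G) (r : Option (Core G)) : Triple G :=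
  (l.bind right₃, k.letter, r.bind left)

/-- The head present in a cell after the next step. -/
def nextHead (l : Option (Core G)) (k : Core G) : Bool := l.elim k.back' head

/-- The set of triples that reaches a cell. -/
def nextKnown (k : Core G) (r : Option (Core G)) : Set (Triple G) :=
  if k.isEnd then k.known else r.elim ∅ known

/-- The letter of a cell after the next step. -/
def nextLetter (l : Option (Core G)) (k : Core G) (r : Option (Core G)) : G :=
  if nextHead l k then h (nextKnown k r) (incoming l k r) else k.letter

/-- The triples met in this block up to a cell. -/
def nextMet (l : Option (Core G)) (k : Core G) (r : Option (Core G)) : Set (Triple G) :=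
  insert (incoming l k r) (l.elim ∅ fun k' => if k'.isEnd then ∅ else k'.met)

/-- The contents of a cell after the next step. -/
def advance (l : Option (Core G)) (k : Core G) (r : Option (Core G)) : Core G where
  letter := nextLetter h l k r
  isEnd := k.isEnd
  head := nextHead l k
  back := if k.isEnd then nextHead l k else r.elim false back
  back' := k.back
  right₁ := if nextHead l k then some (nextLetter h l k r) else l.bind right₃
  right₂ := k.right₁
  right₃ := k.right₂
  left := if nextHead l k then some (nextLetter h l k r) else r.bind left
  met := nextMet l k r
  known := if k.isEnd && nextHead l k then nextMet l k r else nextKnown k r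

end Core

/-- The space-time diagram of a row of `N` cells, in which the time of each cell is counted from its
first activity. -/
structure IsDiagram (h : Set (Triple G) → Triple G → G) (N L : ℕ) (z : ℕ → G)
    (K : ℕ → ℕ → Core G) : Prop where
  pos : 0 < L
  dvd : L ∣ N
  zero : ∀ c < N, K c 0 = Core.start (z c) (decide ((c + 1) % L = 0))
  succ : ∀ c < N, ∀ t, K c (t + 1) = Core.advance h (if 1 ≤ c then some (K (c - 1) (t + 1)) else none)
    (K c t) (if c + 1 < N ∧ 1 ≤ t then some (K (c + 1) (t - 1)) else none)

theorem succ_mod_of_lt {L c : ℕ} (hL : 0 < L) (hc : c % L + 1 < L) :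
    (c + 1) % L = c % L + 1 ∧ (c + 1) / L = c / L := by
  have h1 := Nat.div_add_mod c L
  constructor
  · conv_lhs => rw [← h1, add_assoc, Nat.mul_add_mod, Nat.mod_eq_of_lt hc]
  · conv_lhs => rw [← h1, add_assoc, Nat.mul_add_div hL, Nat.div_eq_of_lt hc, add_zero]

theorem succ_mod_eq_zero_iff {L : ℕ} (hL : 0 < L) (c : ℕ) : (c + 1) % L = 0 ↔ c % L + 1 = L := by
  have h1 := Nat.mod_lt c hL
  have h2 := Nat.div_add_mod c L
  constructor
  · intro h3
    by_contra h4
    rw [(succ_mod_of_lt hL (by omega)).1] at h3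
    omega
  · intro h3
    rw [← h2, add_assoc, h3, Nat.mul_add_mod, Nat.mod_self]

theorem succ_lt_of_dvd {N L c : ℕ} (hL : 0 < L) (hN : L ∣ N) (hc : c < N) (h : c % L + 1 < L) :
    c + 1 < N := by
  by_contra h1
  obtain rfl : N = c + 1 := by omega
  rw [Nat.dvd_iff_mod_eq_zero, succ_mod_eq_zero_iff hL] at hN
  omega

namespace IsDiagram

variable {h : Set (Triple G) → Triple G → G} {N L : ℕ} {z : ℕ → G} {K : ℕ → ℕ → Core G}

theorem isEnd (hK : IsDiagram h N L z K) {c : ℕ} (hc : c < N) (t : ℕ) :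
    (K c t).isEnd = decide ((c + 1) % L = 0) := by
  induction t with
  | zero => rw [hK.zero c hc]; rfl
  | succ t ih => rw [hK.succ c hc, ← ih]; rfl

theorem succ_of_pos (hK : IsDiagram h N L z K) {c : ℕ} (hc : c < N) (t : ℕ) :
    K c (t + 2) = Core.advance h (if 1 ≤ c then some (K (c - 1) (t + 2)) else none)
      (K c (t + 1)) (if c + 1 < N then some (K (c + 1) t) else none) := by
  rw [hK.succ c hc]
  simp

/-- The head moves right as fast as the wave of awakening, so it visits all cells at equal local
times. -/
theorem head_eq (hK : IsDiagram h N L z K) {c : ℕ} (hc : c < N) (t : ℕ) :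
    (K c t).head = (K 0 t).head := by
  induction c with
  | zero => rfl
  | succ c ih =>
    rw [← ih (by omega)]
    rcases t with _ | t
    · rw [hK.zero _ hc, hK.zero _ (by omega)]; rfl
    · rw [hK.succ _ hc]
      simp [Core.advance, Core.nextHead]

theorem back_of_isEnd (hK : IsDiagram h N L z K) {c : ℕ} (hc : c < N) (t : ℕ)
    (he : (c + 1) % L = 0) : (K c t).back = (K c t).head := by
  rcases t with _ | t
  · rw [hK.zero c hc]; simp [Core.start, he]
  · have := hK.isEnd hc t
    rw [hK.succ c hc]
    simp [Core.advance, this, he]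

theorem back_of_not_isEnd (hK : IsDiagram h N L z K) {c : ℕ} (hc : c + 1 < N) (t : ℕ)
    (he : (c + 1) % L ≠ 0) : (K c t).back = if 2 ≤ t then (K (c + 1) (t - 2)).back else false := by
  rcases t with _ | _ | t
  · rw [hK.zero c (by omega)]; simp [Core.start, he]
  · have := hK.isEnd (show c < N by omega) 0
    rw [hK.succ c (by omega)]
    simp [Core.advance, this, he]
  · have := hK.isEnd (show c < N by omega) (t + 1)
    rw [hK.succ_of_pos (by omega)]
    simp [Core.advance, this, he, hc]

/-- Only the first block matters: `back'` is read only by cell 0, which has no left neighbour. -/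
theorem back_eq (hK : IsDiagram h N L z K) (hN : L ≤ N) (d : ℕ) (hd : d < L) (t : ℕ) :
    (K (L - 1 - d) t).back = if 2 * d ≤ t then (K 0 (t - 2 * d)).head else false := by
  induction d generalizing t with
  | zero =>
    rw [hK.back_of_isEnd (by omega) _ (by rw [show L - 1 - 0 + 1 = L by omega, Nat.mod_self]),
      hK.head_eq (by omega)]
    simp
  | succ d ih =>
    rw [hK.back_of_not_isEnd (by omega) _ (by rw [Nat.mod_eq_of_lt (by omega)]; omega),
      show L - 1 - (d + 1) + 1 = L - 1 - d by omega, ih (by omega)]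
    by_cases h1 : 2 * (d + 1) ≤ t
    · rw [if_pos (by omega), if_pos (by omega), if_pos h1]
      congr 2; omega
    · rw [if_neg h1]
      split_ifs <;> first | rfl | omega

theorem back' (hK : IsDiagram h N L z K) {c : ℕ} (hc : c < N) (t : ℕ) :
    (K c (t + 1)).back' = (K c t).back := by
  rw [hK.succ c hc]; rfl

/-- The period is `2 * (L - 1)` units for the signal from the end of the first block back to cell 0,
plus 2 for the turn through `back'`. -/
theorem head_zero (hK : IsDiagram h N L z K) (hN : 0 < N) (t : ℕ) :
    (K 0 t).head = decide (2 * L ∣ t) := by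
  have hL := hK.pos
  have hLN := Nat.le_of_dvd hN hK.dvd
  induction t using Nat.strong_induction_on with
  | _ t ih =>
    rcases t with _ | _ | t
    · rw [hK.zero 0 hN]; simp [Core.start]
    · rw [hK.succ 0 hN, hK.zero 0 hN]
      have : ¬ 2 * L = 1 := by omega
      simp [Core.advance, Core.nextHead, Core.start, this]
    · have h1 : (K 0 (t + 2)).head = (K 0 t).back := by
        rw [hK.succ_of_pos hN]
        simp [Core.advance, Core.nextHead, hK.back' hN]
      have h2 := hK.back_eq hLN (L - 1) (by omega) t
      rw [Nat.sub_self] at h2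
      rw [h1, h2]
      by_cases h3 : 2 * (L - 1) ≤ t
      · rw [if_pos h3, ih _ (by omega)]
        congr 1
        rw [show t + 1 + 1 = t - 2 * (L - 1) + 2 * L by omega, Nat.dvd_add_self_right]
      · rw [if_neg h3, eq_comm, decide_eq_false_iff_not]
        intro h4
        have := Nat.le_of_dvd (by omega) h4
        omega

theorem head (hK : IsDiagram h N L z K) {c : ℕ} (hc : c < N) (t : ℕ) :
    (K c t).head = decide (2 * L ∣ t) := by
  rw [hK.head_eq hc, hK.head_zero (by omega)]

theorem nextHead (hK : IsDiagram h N L z K) {c : ℕ} (hc : c < N) (t : ℕ) :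
    Core.nextHead (if 1 ≤ c then some (K (c - 1) (t + 1)) else none) (K c t) =
      decide (2 * L ∣ t + 1) := by
  rw [← hK.head hc, hK.succ c hc]; rfl

theorem not_dvd (hδ : 0 < δ) (hδL : δ < 2 * L) (r : ℕ) : ¬ 2 * L ∣ 2 * L * r + δ := by
  intro h1
  rw [Nat.dvd_add_right (dvd_mul_right _ _)] at h1
  exact absurd (Nat.le_of_dvd hδ h1) (by omega)

theorem right₃ (hK : IsDiagram h N L z K) {c : ℕ} (hc : c < N) (t : ℕ) :
    (K c (t + 2)).right₃ = (K c t).right₁ := by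
  rw [hK.succ c hc, hK.succ c hc]; rfl

end IsDiagram

/-- The cells of a diagram contain the configuration `y` of a row of blocks at the `r`-th passage of
the head. -/
structure Holds (N L : ℕ) (K : ℕ → ℕ → Core G) (r : ℕ) (y : (ℕ → G) × (ℕ → Set (Triple G))) :
    Prop where
  letter : ∀ c < N, (K c (2 * L * r)).letter = y.1 c
  right₁ : ∀ c < N, (K c (2 * L * r)).right₁ = some (y.1 c)
  left : ∀ c < N, (K c (2 * L * r)).left = some (y.1 c)
  known : ∀ c < N, (c + 1) % L = 0 → (K c (2 * L * r)).known = y.2 (c / L)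

namespace Holds

variable {h : Set (Triple G) → Triple G → G} {N L : ℕ} {z : ℕ → G} {K : ℕ → ℕ → Core G}
  {r : ℕ} {y : (ℕ → G) × (ℕ → Set (Triple G))}

theorem letter_add (hK : IsDiagram h N L z K) (H : Holds N L K r y) {c : ℕ} (hc : c < N) (δ : ℕ)
    (hδ : δ < 2 * L) : (K c (2 * L * r + δ)).letter = y.1 c := by
  induction δ with
  | zero => exact H.letter c hc
  | succ δ ih =>
    have h1 := hK.nextHead hc (2 * L * r + δ)
    have h2 := IsDiagram.not_dvd (show 0 < δ + 1 by omega) hδ r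
    rw [← ih (by omega), ← add_assoc, hK.succ c hc]
    rw [← add_assoc] at h2
    simp [Core.advance, Core.nextLetter, h1, h2]

theorem known_add (hK : IsDiagram h N L z K) (H : Holds N L K r y) {c : ℕ} (hc : c < N)
    (he : (c + 1) % L = 0) (δ : ℕ) (hδ : δ < 2 * L) :
    (K c (2 * L * r + δ)).known = y.2 (c / L) := by
  induction δ with
  | zero => exact H.known c hc he
  | succ δ ih =>
    have h1 := hK.nextHead hc (2 * L * r + δ)
    have h2 := IsDiagram.not_dvd (show 0 < δ + 1 by omega) hδ r
    have h3 := hK.isEnd hc (2 * L * r + δ)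
    rw [← ih (by omega), ← add_assoc, hK.succ c hc]
    rw [← add_assoc] at h2
    simp [Core.advance, Core.nextKnown, h1, h2, h3, he]

/-- The three registers slow the letter to speed 1/3, that is two local units per cell, the same
local pace as a letter moving left. Both thus cover `L` cells in one period. -/
theorem right₁_add (hK : IsDiagram h N L z K) (H : Holds N L K r y) {c : ℕ} (hc : c < N) (e : ℕ)
    (he : e < L) :
    (K c (2 * L * r + 2 * e)).right₁ = if e ≤ c then some (y.1 (c - e)) else none := by
  induction e generalizing c with
  | zero => simpa using H.right₁ c hc
  | succ e ih =>
    have h1 := hK.nextHead hc (2 * L * r + 2 * e + 1)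
    have h2 := IsDiagram.not_dvd (show 0 < 2 * (e + 1) by omega) (show 2 * (e + 1) < 2 * L by omega) r
    rw [show 2 * L * r + 2 * (e + 1) = 2 * L * r + 2 * e + 1 + 1 by ring] at h2 ⊢
    rw [hK.succ c hc]
    simp only [Core.advance, h1, h2]
    rcases c with _ | c
    · simp
    · simp only [Nat.le_add_left, if_true, Nat.add_sub_cancel, Option.bind_some,
        hK.right₃ (show c < N by omega), ih (show c < N by omega) (by omega), Nat.add_le_add_iff_right,
        Nat.add_sub_add_right]
      simp

theorem left_add (hK : IsDiagram h N L z K) (H : Holds N L K r y) {c : ℕ} (hc : c < N) (e : ℕ)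
    (he : e < L) :
    (K c (2 * L * r + 2 * e)).left = if c + e < N then some (y.1 (c + e)) else none := by
  induction e generalizing c with
  | zero => simpa [hc] using H.left c hc
  | succ e ih =>
    have h1 := hK.nextHead hc (2 * L * r + 2 * e + 1)
    have h2 := IsDiagram.not_dvd (show 0 < 2 * (e + 1) by omega) (show 2 * (e + 1) < 2 * L by omega) r
    rw [show 2 * L * r + 2 * (e + 1) = 2 * L * r + 2 * e + 1 + 1 by ring] at h2 ⊢
    rw [hK.succ_of_pos hc]
    simp only [Core.advance, h1, h2]
    by_cases h3 : c + 1 < N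
    · simp [h3, ih h3 (by omega), add_assoc, add_comm 1 e]
    · have h4 : ¬ c + (e + 1) < N := by omega
      simp [h3, h4]

/-- The set spreads left from the end of the block at two units per cell, so a cell at distance `d`
from the end has it after `2 * d` units. -/
theorem known_add_of_le (hK : IsDiagram h N L z K) (H : Holds N L K r y) (d : ℕ) {c : ℕ}
    (hc : c < N) (hd : c % L + d + 1 = L) (δ : ℕ) (hdδ : 2 * d ≤ δ) (hδ : δ < 2 * L) :
    (K c (2 * L * r + δ)).known = y.2 (c / L) := by
  induction d generalizing c δ with
  | zero => exact H.known_add hK hc ((succ_mod_eq_zero_iff hK.pos c).2 (by omega)) δ hδ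
  | succ d ih =>
    obtain ⟨δ, rfl⟩ : ∃ δ', δ = δ' + 2 := ⟨δ - 2, by omega⟩
    obtain ⟨h1, h2⟩ := succ_mod_of_lt hK.pos (show c % L + 1 < L by omega)
    have h3 := succ_lt_of_dvd hK.pos hK.dvd hc (show c % L + 1 < L by omega)
    have h4 := ih h3 (by omega) δ (by omega) (by omega)
    have h5 := hK.isEnd hc (2 * L * r + δ + 1)
    rw [h2] at h4
    rw [← h4, ← add_assoc, hK.succ_of_pos hc]
    simp [Core.advance, Core.nextKnown, h5, h1, h3]

theorem nextKnown (hK : IsDiagram h N L z K) (H : Holds N L K r y) {c : ℕ} (hc : c < N) :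
    Core.nextKnown (K c (2 * L * r + 2 * (L - 1) + 1))
      (if c + 1 < N then some (K (c + 1) (2 * L * r + 2 * (L - 1))) else none) = y.2 (c / L) := by
  have hL := hK.pos
  have h5 := hK.isEnd hc (2 * L * r + 2 * (L - 1) + 1)
  by_cases h0 : (c + 1) % L = 0
  · have := H.known_add hK hc h0 (2 * (L - 1) + 1) (by omega)
    rw [← add_assoc] at this
    simp [Core.nextKnown, h5, h0, this]
  · have hlt := Nat.mod_lt c hL
    have h6 : c % L + 1 < L := by
      rw [succ_mod_eq_zero_iff hL] at h0
      omega
    obtain ⟨h1, h2⟩ := succ_mod_of_lt hL h6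
    have h3 := succ_lt_of_dvd hL hK.dvd hc h6
    have := H.known_add_of_le hK (L - 1 - (c + 1) % L) h3 (by omega) (2 * (L - 1)) (by omega) (by omega)
    simp [Core.nextKnown, h5, h0, this, h3, h2]

theorem incoming (hK : IsDiagram h N L z K) (H : Holds N L K r y) {c : ℕ} (hc : c < N) :
    Core.incoming (if 1 ≤ c then some (K (c - 1) (2 * L * r + 2 * (L - 1) + 2)) else none)
      (K c (2 * L * r + 2 * (L - 1) + 1))
      (if c + 1 < N then some (K (c + 1) (2 * L * r + 2 * (L - 1))) else none) =
      triple N L y.1 c := by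
  have hL := hK.pos
  rw [Core.incoming, triple]
  refine Prod.ext ?_ (Prod.ext ?_ ?_)
  · rcases c with _ | c
    · have : ¬ L ≤ 0 := by omega
      simp [this]
    · simp only [Nat.le_add_left, if_true, Nat.add_sub_cancel, Option.bind_some,
        hK.right₃ (show c < N by omega), H.right₁_add hK (show c < N by omega) (L - 1) (by omega)]
      by_cases h1 : L ≤ c + 1
      · rw [if_pos h1, if_pos (by omega), show c - (L - 1) = c + 1 - L by omega]
      · rw [if_neg h1, if_neg (by omega)]
  · exact H.letter_add hK hc (2 * (L - 1) + 1) (by omega)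
  · by_cases h1 : c + 1 < N
    · simp only [h1, if_true, Option.bind_some, H.left_add hK h1 (L - 1) (by omega)]
      rw [show c + 1 + (L - 1) = c + L by omega]
    · have h2 : ¬ c + L < N := by omega
      simp [h1, h2]

/-- Within one local instant data can cross the whole block to the right, so the set is accumulated
from cell to cell; it is emptied on leaving a block. -/
theorem met (hK : IsDiagram h N L z K) (H : Holds N L K r y) {c : ℕ} (hc : c < N) :
    (K c (2 * L * r + 2 * (L - 1) + 2)).met =
      {t | ∃ c' ≤ c, c' / L = c / L ∧ t = triple N L y.1 c'} := by
  have hL := hK.pos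
  induction c with
  | zero =>
    have h1 := H.incoming hK hc
    rw [hK.succ_of_pos hc]
    simp only [Core.advance, Core.nextMet, h1]
    ext t
    simp [hL]
  | succ c ih =>
    have h1 := H.incoming hK hc
    have hcN : c < N := by omega
    have h2 := hK.isEnd hcN (2 * L * r + 2 * (L - 1) + 2)
    rw [hK.succ_of_pos hc]
    simp only [Core.advance, Core.nextMet, h1]
    simp only [Nat.le_add_left, if_true, Nat.add_sub_cancel, Option.elim_some, h2, ih hcN]
    by_cases h0 : (c + 1) % L = 0
    · simp only [h0, decide_true, if_true]
      ext t
      simp only [Set.mem_insert_iff, Set.mem_empty_iff_false, or_false, Set.mem_ofPred_eq]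
      constructor
      · intro ht
        exact ⟨c + 1, le_rfl, rfl, ht⟩
      · rintro ⟨c', h3, h4, h5⟩
        rcases h3.eq_or_lt with rfl | h3
        · exact h5
        · exfalso
          have h6 := Nat.div_add_mod (c + 1) L
          have h7 := Nat.div_mul_le_self c' L
          rw [h0, add_zero, ← h4, mul_comm] at h6
          omega
    · have hlt := Nat.mod_lt c hL
      have h6 : c % L + 1 < L := by
        rw [succ_mod_eq_zero_iff hL] at h0
        omega
      obtain ⟨-, h7⟩ := succ_mod_of_lt hL h6
      simp only [h0, decide_false, if_false, Bool.false_eq_true]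
      ext t
      simp only [Set.mem_insert_iff, Set.mem_ofPred_eq, h7]
      constructor
      · rintro (ht | ⟨c', h3, h4, h5⟩)
        · exact ⟨c + 1, le_rfl, h7, ht⟩
        · exact ⟨c', by omega, h4, h5⟩
      · rintro ⟨c', h3, h4, h5⟩
        rcases h3.eq_or_lt with rfl | h3
        · exact Or.inl h5
        · exact Or.inr ⟨c', by omega, h4, h5⟩

theorem step (hK : IsDiagram h N L z K) (H : Holds N L K r y) :
    Holds N L K (r + 1) (blockStep h N L y) := by
  have hL := hK.pos
  have ht : 2 * L * (r + 1) = 2 * L * r + 2 * (L - 1) + 2 := by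
    rw [mul_add, mul_one]; omega
  have hh : ∀ c < N, Core.nextHead
      (if 1 ≤ c then some (K (c - 1) (2 * L * r + 2 * (L - 1) + 2)) else none)
      (K c (2 * L * r + 2 * (L - 1) + 1)) = true := by
    intro c hc
    rw [hK.nextHead hc, decide_eq_true_iff, ← ht]
    exact dvd_mul_right _ _
  have hx : ∀ c < N, Core.nextLetter h
      (if 1 ≤ c then some (K (c - 1) (2 * L * r + 2 * (L - 1) + 2)) else none)
      (K c (2 * L * r + 2 * (L - 1) + 1))
      (if c + 1 < N then some (K (c + 1) (2 * L * r + 2 * (L - 1))) else none) =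
      (blockStep h N L y).1 c := by
    intro c hc
    rw [Core.nextLetter, hh c hc, if_pos rfl, H.incoming hK hc, H.nextKnown hK hc]
    rfl
  refine ⟨fun c hc => ?_, fun c hc => ?_, fun c hc => ?_, fun c hc he => ?_⟩
  · rw [ht, hK.succ_of_pos hc]
    exact hx c hc
  · rw [ht, hK.succ_of_pos hc]
    simp only [Core.advance, hh c hc, hx c hc, if_true]
  · rw [ht, hK.succ_of_pos hc]
    simp only [Core.advance, hh c hc, hx c hc, if_true]
  · have h1 := H.met hK hc
    have h2 := hK.isEnd hc (2 * L * r + 2 * (L - 1) + 1)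
    rw [hK.succ_of_pos hc] at h1
    rw [ht, hK.succ_of_pos hc]
    simp only [Core.advance, hh c hc, h2, he, decide_true, Bool.and_self, if_true] at h1 ⊢
    rw [h1]
    ext t
    constructor
    · rintro ⟨c', h3, h4, h5⟩
      exact ⟨c', by omega, h4, h5⟩
    · rintro ⟨c', h3, h4, h5⟩
      -- The cell `c` ends its block, so a cell `c'` of the same block cannot exceed it.
      refine ⟨c', ?_, h4, h5⟩
      by_contra h6
      have h7 : (c + 1) / L ≤ c' / L := Nat.div_le_div_right (by omega)
      have h8 := Nat.div_add_mod (c + 1) L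
      have h9 := Nat.div_mul_le_self c L
      have h10 : (c + 1) / L * L ≤ c / L * L := Nat.mul_le_mul_right L (by omega)
      rw [he, add_zero, mul_comm] at h8
      omega

end Holds

theorem IsDiagram.holds {h : Set (Triple G) → Triple G → G} {N L : ℕ} {z : ℕ → G}
    {K : ℕ → ℕ → Core G} (hK : IsDiagram h N L z K) (r : ℕ) :
    Holds N L K r ((blockStep h N L)^[r] (z, fun _ => ∅)) := by
  induction r with
  | zero =>
    constructor <;> intro c hc <;> rw [mul_zero, hK.zero c hc]
    · rfl
    · rfl
    · rfl
    · intro _; rfl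
  | succ r ih =>
    rw [Function.iterate_succ_apply']
    exact ih.step hK

/-- The letters of a diagram are those of the row of blocks. -/
theorem IsDiagram.letter {h : Set (Triple G) → Triple G → G} {N L : ℕ} {z : ℕ → G}
    {K : ℕ → ℕ → Core G} (hK : IsDiagram h N L z K) {c : ℕ} (hc : c < N) (t : ℕ) :
    (K c t).letter = ((blockStep h N L)^[t / (2 * L)] (z, fun _ => ∅)).1 c := by
  have hL := hK.pos
  conv_lhs => rw [← Nat.div_add_mod t (2 * L)]
  exact (hK.holds _).letter_add hK hc _ (Nat.mod_lt _ (by omega))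

end Blocks

/-! ### The automaton realizing the skewed diagram. -/

section Automaton

variable {I O G : Type}

theorem site_succ (A : WordAutomaton I O) (w : List I) (c : ℤ) (t : ℕ) : A.site w c (t + 1) =
    A.rule (A.site w (c - 1) t) (A.site w c t) (A.site w (c + 1) t) := by
  simp only [WordAutomaton.site, Function.iterate_succ_apply']
  rfl

theorem site_border (A : WordAutomaton I O) (w : List I) (c : ℤ) (hc : c < 0 ∨ (w.length : ℤ) ≤ c) (t : ℕ) :
    A.site w c t = A.border := by
  induction t with
  | zero =>
    simp only [WordAutomaton.site, Function.iterate_zero_apply, WordAutomaton.initial]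
    split_ifs with h0
    · rw [List.getElem?_eq_none (by omega)]; rfl
    · rfl
  | succ t ih => rw [site_succ, ih, A.border_persistent]


/-- The states of the simulating automaton: the border, input letters and active cells. -/
abbrev SimState (I G : Type) : Type := Option (I ⊕ Core G)

/-- The contents of an active cell. -/
def SimState.core? : SimState I G → Option (Core G)
  | some (.inr k) => some k
  | _ => none

/-- The automaton that simulates a row of blocks. Its cells become active one after the other from
the left to the right. -/
noncomputable def simulator [Finite I] [Finite G] (h : Set (Triple G) → Triple G → G) (g : I → G)
    (e : I → Bool) (out : G → O) (blank : O) : WordAutomaton I O where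
  State := SimState I G
  finite := inferInstance
  rule
    | _, none, _ => none
    | some (.inl _), some (.inl a), _ => some (.inl a)
    | _, some (.inl a), _ => some (.inr (Core.start (g a) (e a)))
    | l, some (.inr k), r => some (.inr (Core.advance h l.core? k r.core?))
  border := none
  border_persistent := by rintro (_ | _ | _) _ <;> rfl
  letter := ⟨fun a => some (.inl a), fun a b hab => by simpa using hab⟩
  letter_ne_border := by simp
  proj
    | some (.inr k) => out k.letter
    | _ => blank

variable [Finite I] [Finite G] (h : Set (Triple G) → Triple G → G) (g : I → G) (e : I → Bool)
  (out : G → O) (blank : O) (w : List I)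

theorem simulator_site_input (c : ℕ) (hc : c < w.length) (t : ℕ) (ht : t ≤ c) :
    (simulator h g e out blank).site w c t = some (.inl w[c]) := by
  induction t generalizing c with
  | zero => simp [WordAutomaton.site, WordAutomaton.initial, hc]; rfl
  | succ t ih =>
    rw [site_succ, ih c hc (by omega), show (c : ℤ) - 1 = ((c - 1 : ℕ) : ℤ) by omega,
      ih (c - 1) (by omega) (by omega)]
    rfl

theorem simulator_site_active (t c : ℕ) (hc : c < w.length) (hct : c < t) :
    ∃ k, (simulator h g e out blank).site w c t = some (.inr k) := by
  induction t generalizing c with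
  | zero => omega
  | succ t ih =>
    rw [site_succ]
    rcases (show c = t ∨ c < t by omega) with rfl | hct
    · rw [simulator_site_input h g e out blank w c hc c le_rfl]
      rcases c with _ | c
      · rw [site_border _ _ _ (Or.inl (by omega))]
        exact ⟨_, rfl⟩
      · obtain ⟨k, hk⟩ := ih c (by omega) (by omega)
        rw [show ((c + 1 : ℕ) : ℤ) - 1 = (c : ℤ) by omega, hk]
        exact ⟨_, rfl⟩
    · obtain ⟨k, hk⟩ := ih c hc hct
      rw [hk]
      exact ⟨_, rfl⟩

theorem simulator_site_first (c : ℕ) (hc : c < w.length) :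
    (simulator h g e out blank).site w c (c + 1) = some (.inr (Core.start (g w[c]) (e w[c]))) := by
  rw [site_succ, simulator_site_input h g e out blank w c hc c le_rfl]
  rcases c with _ | c
  · rw [site_border _ _ _ (Or.inl (by omega))]
    rfl
  · obtain ⟨k, hk⟩ := simulator_site_active h g e out blank w (c + 1) c (by omega) (by omega)
    rw [show ((c + 1 : ℕ) : ℤ) - 1 = (c : ℤ) by omega, hk]
    rfl

/-- Cell `c` at local time `t` is at global time `c + 1 + t`. At that moment its left neighbour has
local time `t + 1` and its right neighbour `t - 1`, or is still asleep if `t = 0`. -/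
theorem simulator_isDiagram {L : ℕ} (hL : 0 < L) (hLw : L ∣ w.length) (z : ℕ → G)
    (hz : ∀ c (hc : c < w.length), z c = g w[c])
    (he : ∀ c (hc : c < w.length), e w[c] = decide ((c + 1) % L = 0)) :
    ∃ K, IsDiagram h w.length L z K ∧ ∀ c < w.length, ∀ t,
      (simulator h g e out blank).site w c (c + 1 + t) = some (.inr (K c t)) := by
  have : Nonempty (Core G) := ⟨Core.start (z 0) false⟩
  have hex : ∀ c t, c < w.length →
      ∃ k, (simulator h g e out blank).site w c (c + 1 + t) = some (.inr k) := fun c t hc =>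
    simulator_site_active h g e out blank w _ c hc (by omega)
  choose! K hK using hex
  refine ⟨K, ⟨hL, hLw, fun c hc => ?_, fun c hc t => ?_⟩, fun c hc t => hK c t hc⟩
  · have h1 := hK c 0 hc
    rw [add_zero, simulator_site_first h g e out blank w c hc, ← hz c hc, he c hc] at h1
    exact (Sum.inr_injective (Option.some_injective _ h1)).symm
  · have h1 := hK c (t + 1) hc
    rw [← add_assoc, site_succ, hK c t hc] at h1
    have hl : SimState.core? ((simulator h g e out blank).site w ((c : ℤ) - 1) (c + 1 + t)) =
        if 1 ≤ c then some (K (c - 1) (t + 1)) else none := by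
      split_ifs with h0
      · rw [show (c : ℤ) - 1 = ((c - 1 : ℕ) : ℤ) by omega,
          show c + 1 + t = c - 1 + 1 + (t + 1) by omega, hK _ _ (by omega)]
        rfl
      · rw [site_border _ _ _ (Or.inl (by omega))]
        rfl
    have hr : SimState.core? ((simulator h g e out blank).site w ((c : ℤ) + 1) (c + 1 + t)) =
        if c + 1 < w.length ∧ 1 ≤ t then some (K (c + 1) (t - 1)) else none := by
      by_cases h0 : c + 1 < w.length
      · rw [show (c : ℤ) + 1 = ((c + 1 : ℕ) : ℤ) by omega]
        split_ifs with h2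
        · rw [show c + 1 + t = c + 1 + 1 + (t - 1) by omega, hK _ _ h0]
          rfl
        · rw [simulator_site_input h g e out blank w (c + 1) h0 _ (by omega)]
          rfl
      · rw [if_neg (fun h2 => h0 h2.1), site_border _ _ _ (Or.inr (by omega))]
        rfl
    rw [← hl, ← hr]
    exact (Sum.inr_injective (Option.some_injective _ h1)).symm

/-- The automaton simulates rows of blocks. -/
theorem simulator_proj {L : ℕ} (hL : 0 < L) (hLw : L ∣ w.length) (z : ℕ → G)
    (hz : ∀ c (hc : c < w.length), z c = g w[c])
    (he : ∀ c (hc : c < w.length), e w[c] = decide ((c + 1) % L = 0)) (c : ℕ) (hc : c < w.length)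
    (t : ℕ) :
    (simulator h g e out blank).proj ((simulator h g e out blank).site w c (c + 1 + t)) =
      out (((blockStep h w.length L)^[t / (2 * L)] (z, fun _ => ∅)).1 c) := by
  obtain ⟨K, hK, hsite⟩ := simulator_isDiagram h g e out blank w hL hLw z hz he
  rw [hsite c hc, ← hK.letter hc]
  rfl

end Automaton

/-! ### Compensating for the delay of the block sets. -/

section TwoPhases

variable {G : Type}

/-- A step of a row of blocks in which the new letters depend on the triples of letters and on the
set of the triples in the block. -/
def fullStep (h : Set (Triple G) → Triple G → G) (N L : ℕ) (z : ℕ → G) (c : ℕ) : G :=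
  h (blockTriples N L z (c / L)) (triple N L z c)

/-- Apply a function to the letters of a triple. -/
def Triple.map {G H : Type} (f : G → H) (t : Triple G) : Triple H :=
  (t.1.map f, f t.2.1, t.2.2.map f)

theorem Triple.map_injective {G H : Type} {f : G → H} (hf : f.Injective) :
    (Triple.map f).Injective := by
  rintro ⟨a, b, c⟩ ⟨a', b', c'⟩ hab
  simp only [Triple.map, Prod.mk.injEq] at hab
  rw [Option.map_injective hf hab.1, hf hab.2.1, Option.map_injective hf hab.2.2]

theorem triple_comp {G H : Type} (f : G → H) (N L : ℕ) (z : ℕ → G) (c : ℕ) :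
    triple N L (f ∘ z) c = (triple N L z c).map f := by
  unfold triple Triple.map
  split_ifs <;> rfl

/-- Perform a full step in two steps: first store the triple, then apply the rule. -/
def twoPhase (h : Set (Triple G) → Triple G → G) (S : Set (Triple (G ⊕ Triple G)))
    (t : Triple (G ⊕ Triple G)) : G ⊕ Triple G :=
  match t.2.1 with
  | .inl x => .inr (t.1.bind Sum.getLeft?, x, t.2.2.bind Sum.getLeft?)
  | .inr s => .inl (h {s' | s'.map Sum.inl ∈ S} s)

theorem blockStep_twoPhase (h : Set (Triple G) → Triple G → G) (N L : ℕ) (z : ℕ → G)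
    (S : ℕ → Set (Triple (G ⊕ Triple G))) :
    blockStep (twoPhase h) N L (Sum.inl ∘ z, S) =
      (fun c => .inr (triple N L z c), blockTriples N L (Sum.inl ∘ z)) := by
  refine Prod.ext (funext fun c => ?_) rfl
  simp only [blockStep, twoPhase, triple]
  split_ifs <;> rfl

/-- In the second phase the delayed set consists of the triples of the first phase, whose letters
are all of the form `inl`, so pulling it back along `inl` gives the set of the current step. -/
theorem blockStep_blockStep_twoPhase (h : Set (Triple G) → Triple G → G) (N L : ℕ) (z : ℕ → G)
    (S : ℕ → Set (Triple (G ⊕ Triple G))) :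
    ∃ S', blockStep (twoPhase h) N L (blockStep (twoPhase h) N L (Sum.inl ∘ z, S)) =
      (Sum.inl ∘ fullStep h N L z, S') := by
  rw [blockStep_twoPhase]
  refine ⟨_, Prod.ext (funext fun c => ?_) rfl⟩
  simp only [blockStep, Function.comp_apply, twoPhase, fullStep]
  rw [triple]
  simp only
  congr 2
  ext s
  simp only [blockTriples, triple_comp, Set.mem_ofPred_eq,
    (Triple.map_injective Sum.inl_injective).eq_iff]

theorem iterate_blockStep_twoPhase (h : Set (Triple G) → Triple G → G) (N L : ℕ) (z : ℕ → G)
    (S : ℕ → Set (Triple (G ⊕ Triple G))) (r : ℕ) :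
    ∃ S', (blockStep (twoPhase h) N L)^[2 * r] (Sum.inl ∘ z, S) =
      (Sum.inl ∘ (fullStep h N L)^[r] z, S') := by
  induction r with
  | zero => exact ⟨S, rfl⟩
  | succ r ih =>
    obtain ⟨S', hS'⟩ := ih
    rw [show 2 * (r + 1) = 2 * r + 1 + 1 by ring, Function.iterate_succ_apply',
      Function.iterate_succ_apply', hS', Function.iterate_succ_apply' (fullStep h N L)]
    exact blockStep_blockStep_twoPhase h N L _ S'

/-- The letter at the beginning of the current full step. -/
def currentLetter : G ⊕ Triple G → G
  | .inl x => x
  | .inr t => t.2.1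

theorem currentLetter_iterate (h : Set (Triple G) → Triple G → G) (N L : ℕ) (z : ℕ → G)
    (S : ℕ → Set (Triple (G ⊕ Triple G))) (r c : ℕ) :
    currentLetter (((blockStep (twoPhase h) N L)^[r] (Sum.inl ∘ z, S)).1 c) =
      (fullStep h N L)^[r / 2] z c := by
  obtain ⟨S', hS'⟩ := iterate_blockStep_twoPhase h N L z S (r / 2)
  rcases Nat.mod_two_eq_zero_or_one r with hr | hr
  · rw [show r = 2 * (r / 2) by omega, hS', show 2 * (r / 2) / 2 = r / 2 by omega]
    rfl
  · conv_lhs => rw [show r = 2 * (r / 2) + 1 by omega]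
    rw [Function.iterate_succ_apply', hS', blockStep_twoPhase]
    rfl

theorem triple_congr {N L : ℕ} {z z' : ℕ → G} (hz : ∀ c < N, z c = z' c) {c : ℕ} (hc : c < N) :
    triple N L z c = triple N L z' c := by
  unfold triple
  rw [hz c hc, hz (c - L) (by omega)]
  split_ifs with h1 h2 h2 <;> first | rfl | rw [hz _ h2]

/-- Needed because processors and letters are known to correspond only inside the row. -/
theorem fullStep_congr (h : Set (Triple G) → Triple G → G) {N L : ℕ} {z z' : ℕ → G}
    (hz : ∀ c < N, z c = z' c) {c : ℕ} (hc : c < N) :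
    fullStep h N L z c = fullStep h N L z' c := by
  unfold fullStep
  rw [triple_congr hz hc]
  congr 1
  ext t
  constructor
  · rintro ⟨c', h1, h2, h3⟩
    exact ⟨c', h1, h2, h3.trans (triple_congr hz h1)⟩
  · rintro ⟨c', h1, h2, h3⟩
    exact ⟨c', h1, h2, h3.trans (triple_congr hz h1).symm⟩

end TwoPhases

/-! ### Processors as blocks of bits followed by a tag. -/

section Bits

/-- A letter holds a bit of each of the two registers of a processor and a mark that tells whether
the first one is displayed, or it holds the tag. -/
abbrev Letter : Type := (Bool × Bool × Bool) ⊕ Tag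

/-- The bits of the registers. -/
def Letter.bits? : Letter → Option (Bool × Bool)
  | .inl b => some (b.1, b.2.1)
  | .inr _ => none

/-- The tag. -/
def Letter.tag? : Letter → Option Tag
  | .inl _ => none
  | .inr t => some t

open Classical in
/-- The action of a block, which is determined by its triples. -/
noncomputable def actionOf (S : Set (Triple Letter)) : Tag × (Side × Bool) × (Side × Bool) :=
  let s := Classical.epsilon fun s : Triple Letter => s ∈ S ∧ ∃ t, s.2.1 = .inr t
  action (s.1.bind Letter.tag?) ((Letter.tag? s.2.1).getD .empty) (s.2.2.bind Letter.tag?)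
    (decide (∀ t ∈ S, ∀ x ∈ Letter.bits? t.2.1, ∀ y ∈ t.2.2.bind Letter.bits?, y.2 = x.1))
    (decide (∀ t ∈ S, ∀ x ∈ Letter.bits? t.2.1, ∀ y ∈ t.1.bind Letter.bits?, y.2 = x.2))
    (decide (∀ t ∈ S, ∀ x ∈ Letter.bits? t.2.1, ∀ y ∈ t.2.2.bind Letter.bits?, x.2 = y.2))

/-- The new letter of a cell. -/
noncomputable def letterRule (S : Set (Triple Letter)) (t : Triple Letter) : Letter :=
  match t.2.1 with
  | .inl b => .inl
      (fetch (t.1.bind Letter.bits?) (b.1, b.2.1) (t.2.2.bind Letter.bits?) (actionOf S).2.1,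
        fetch (t.1.bind Letter.bits?) (b.1, b.2.1) (t.2.2.bind Letter.bits?) (actionOf S).2.2,
        (actionOf S).1.shown)
  | .inr _ => .inr (actionOf S).1

variable {l : ℕ}

/-- The letter at place `k` of the block that represents a processor. -/
def cellLetter (x : Proc (Vertex l)) (k : ℕ) : Letter :=
  if h : k < l then .inl (x.fst ⟨k, h⟩, x.snd ⟨k, h⟩, x.tag.shown) else .inr x.tag

/-- The row of blocks that represents a row of processors. -/
def rowLetters (c : ℕ → Proc (Vertex l)) (i : ℕ) : Letter :=
  cellLetter (c (i / (l + 1))) (i % (l + 1))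

/-- The triple at place `k` of the block that represents a processor with given neighbours. -/
def cellTriple (y : Option (Proc (Vertex l))) (x : Proc (Vertex l)) (z : Option (Proc (Vertex l)))
    (k : ℕ) : Triple Letter :=
  (y.map fun x => cellLetter x k, cellLetter x k, z.map fun x => cellLetter x k)

theorem fetch_apply (y : Option (Vertex l × Vertex l)) (x : Vertex l × Vertex l)
    (z : Option (Vertex l × Vertex l)) (s : Side × Bool) (k : Fin l) :
    fetch y x z s k = fetch (y.map fun a => (a.1 k, a.2 k)) (x.1 k, x.2 k)
      (z.map fun a => (a.1 k, a.2 k)) s := by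
  obtain ⟨s, b⟩ := s
  cases s <;> cases b <;> cases y <;> cases z <;> rfl

theorem bits?_cellLetter (x : Proc (Vertex l)) (k : Fin l) :
    Letter.bits? (cellLetter x k) = some (x.fst k, x.snd k) := by
  simp [cellLetter, Letter.bits?]

theorem bind_bits?_cellLetter (y : Option (Proc (Vertex l))) (k : Fin l) :
    (y.map fun x => cellLetter x k).bind Letter.bits? =
      y.map fun x => (x.fst k, x.snd k) := by
  cases y
  · rfl
  · exact bits?_cellLetter _ _

theorem bind_tag?_cellLetter (y : Option (Proc (Vertex l))) :
    (y.map fun x => cellLetter x l).bind Letter.tag? = y.map Proc.tag := by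
  cases y
  · rfl
  · simp [cellLetter, Letter.tag?]

theorem bits?_cellLetter_eq_none (x : Proc (Vertex l)) {k : ℕ} (hk : ¬ k < l) :
    Letter.bits? (cellLetter x k) = none := by
  simp [cellLetter, Letter.bits?, hk]

/-- Comparisons of registers are comparisons of all bits. -/
theorem forall_cellTriple (y : Option (Proc (Vertex l))) (x : Proc (Vertex l))
    (z : Option (Proc (Vertex l))) (P : Triple Letter → Bool × Bool → Prop) :
    (∀ t ∈ {t | ∃ k < l + 1, t = cellTriple y x z k}, ∀ b ∈ Letter.bits? t.2.1, P t b) ↔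
      ∀ k : Fin l, P (cellTriple y x z k) (x.fst k, x.snd k) := by
  constructor
  · intro h k
    exact h _ ⟨k, by omega, rfl⟩ _ (by simp [cellTriple, bits?_cellLetter])
  · rintro h t ⟨k, hk, rfl⟩ b hb
    by_cases hkl : k < l
    · have h1 := bits?_cellLetter x ⟨k, hkl⟩
      simp only [cellTriple] at hb
      rw [h1] at hb
      obtain rfl := Option.some_injective _ hb
      exact h ⟨k, hkl⟩
    · simp [cellTriple, bits?_cellLetter_eq_none x hkl] at hb

/-- Two registers agree iff all their bits agree, a condition on the set of triples alone that needs
no positions. -/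
theorem actionOf_cellTriple (y : Option (Proc (Vertex l))) (x : Proc (Vertex l))
    (z : Option (Proc (Vertex l))) :
    actionOf {t | ∃ k < l + 1, t = cellTriple y x z k} = Proc.act y x z := by
  -- The choice is forced: only place `l` of a block carries a tag.
  have hs : Classical.epsilon (fun s : Triple Letter =>
      s ∈ {t | ∃ k < l + 1, t = cellTriple y x z k} ∧ ∃ t, s.2.1 = .inr t) = cellTriple y x z l := by
    obtain ⟨⟨k, hk, h1⟩, t, h2⟩ := Classical.epsilon_spec
      (p := fun s : Triple Letter =>
        s ∈ {t | ∃ k < l + 1, t = cellTriple y x z k} ∧ ∃ t, s.2.1 = .inr t)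
      ⟨cellTriple y x z l, ⟨l, by omega, rfl⟩, x.tag, by simp [cellTriple, cellLetter]⟩
    rw [h1]
    rw [h1] at h2
    have : ¬ k < l := by
      intro hkl
      simp [cellTriple, cellLetter, hkl] at h2
    rw [show k = l by omega]
  rw [actionOf, Proc.act]
  simp only [hs, forall_cellTriple]
  simp only [cellTriple, bind_tag?_cellLetter, bind_bits?_cellLetter]
  congr 1
  · simp [cellLetter, Letter.tag?]
  · congr 1
    cases z <;> simp [funext_iff]
  · congr 1
    cases y <;> simp [funext_iff]
  · congr 1
    cases z <;> simp [funext_iff]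

theorem letterRule_cellTriple (y : Option (Proc (Vertex l))) (x : Proc (Vertex l))
    (z : Option (Proc (Vertex l))) (k : ℕ) :
    letterRule {t | ∃ k < l + 1, t = cellTriple y x z k} (cellTriple y x z k) =
      cellLetter (Proc.next y x z) k := by
  rw [letterRule, actionOf_cellTriple]
  by_cases hk : k < l
  · have hx : cellLetter x k = .inl (x.fst ⟨k, hk⟩, x.snd ⟨k, hk⟩, x.tag.shown) := by
      simp [cellLetter, hk]
    have h1 := bind_bits?_cellLetter y ⟨k, hk⟩
    have h2 := bind_bits?_cellLetter z ⟨k, hk⟩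
    simp only at h1 h2
    simp only [cellTriple, hx, h1, h2]
    simp only [cellLetter, hk, dite_true, Proc.next, fetch_apply, Option.map_map]
    rfl
  · have hx : cellLetter x k = .inr x.tag := by simp [cellLetter, hk]
    simp only [cellTriple, hx]
    simp [cellLetter, hk, Proc.next]

theorem triple_rowLetters (m : ℕ) (c : ℕ → Proc (Vertex l)) (i : ℕ) :
    triple (m * (l + 1)) (l + 1) (rowLetters c) i =
      cellTriple (if 1 ≤ i / (l + 1) then some (c (i / (l + 1) - 1)) else none) (c (i / (l + 1)))
        (if i / (l + 1) + 1 < m then some (c (i / (l + 1) + 1)) else none) (i % (l + 1)) := by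
  have h1 : l + 1 ≤ i ↔ 1 ≤ i / (l + 1) := by rw [Nat.le_div_iff_mul_le (by omega), one_mul]
  have h2 : i + (l + 1) < m * (l + 1) ↔ i / (l + 1) + 1 < m := by
    rw [← Nat.add_div_right i (show 0 < l + 1 by omega), Nat.div_lt_iff_lt_mul (by omega)]
  have e1 : l + 1 ≤ i → rowLetters c (i - (l + 1)) =
      cellLetter (c (i / (l + 1) - 1)) (i % (l + 1)) := by
    intro h
    rw [rowLetters, ← Nat.mod_eq_sub_mod h, Nat.div_eq_sub_div (by omega) h]
    simp
  have e2 : rowLetters c (i + (l + 1)) = cellLetter (c (i / (l + 1) + 1)) (i % (l + 1)) := by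
    rw [rowLetters, Nat.add_mod_right, Nat.add_div_right _ (by omega)]
  refine Prod.ext ?_ (Prod.ext rfl ?_)
  · simp only [triple, cellTriple]
    by_cases h : l + 1 ≤ i
    · rw [if_pos h, if_pos (h1.1 h), e1 h]; rfl
    · rw [if_neg h, if_neg (fun h' => h (h1.2 h'))]; rfl
  · simp only [triple, cellTriple, e2]
    by_cases h : i + (l + 1) < m * (l + 1)
    · rw [if_pos h, if_pos (h2.1 h)]; rfl
    · rw [if_neg h, if_neg (fun h' => h (h2.2 h'))]; rfl

theorem blockTriples_rowLetters (m : ℕ) (c : ℕ → Proc (Vertex l)) {j : ℕ} (hj : j < m) :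
    blockTriples (m * (l + 1)) (l + 1) (rowLetters c) j =
      {t | ∃ k < l + 1, t = cellTriple (if 1 ≤ j then some (c (j - 1)) else none) (c j)
        (if j + 1 < m then some (c (j + 1)) else none) k} := by
  ext t
  constructor
  · rintro ⟨i, hi, rfl, rfl⟩
    exact ⟨i % (l + 1), Nat.mod_lt _ (by omega), triple_rowLetters m c i⟩
  · rintro ⟨k, hk, rfl⟩
    have hi : j * (l + 1) + k < m * (l + 1) :=
      calc j * (l + 1) + k < (j + 1) * (l + 1) := by rw [add_mul, one_mul]; omega
        _ ≤ m * (l + 1) := Nat.mul_le_mul_right _ hj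
    have h1 : (j * (l + 1) + k) / (l + 1) = j := by
      rw [mul_comm, Nat.mul_add_div (by omega), Nat.div_eq_of_lt hk, add_zero]
    have h2 : (j * (l + 1) + k) % (l + 1) = k := by
      rw [mul_comm, Nat.mul_add_mod, Nat.mod_eq_of_lt hk]
    refine ⟨_, hi, h1, ?_⟩
    rw [triple_rowLetters m c, h1, h2]

theorem fullStep_rowLetters (m : ℕ) (c : ℕ → Proc (Vertex l)) {i : ℕ} (hi : i < m * (l + 1)) :
    fullStep letterRule (m * (l + 1)) (l + 1) (rowLetters c) i = rowLetters (Proc.step m c) i := by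
  rw [fullStep, triple_rowLetters m c,
    blockTriples_rowLetters m c ((Nat.div_lt_iff_lt_mul (by omega)).2 hi), letterRule_cellTriple]
  rfl

theorem iterate_fullStep_rowLetters (m : ℕ) (c : ℕ → Proc (Vertex l)) (r : ℕ) :
    ∀ i < m * (l + 1), (fullStep letterRule (m * (l + 1)) (l + 1))^[r] (rowLetters c) i =
      rowLetters ((Proc.step m)^[r] c) i := by
  induction r with
  | zero => exact fun _ _ => rfl
  | succ r ih =>
    intro i hi
    rw [Function.iterate_succ_apply', Function.iterate_succ_apply', fullStep_congr _ ih hi,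
      fullStep_rowLetters m _ hi]

end Bits

/-! ### Input and output words, and the time bound. -/

section Words

theorem getElem?_flatMap {α β : Type} (f : α → List β) {L : ℕ} (hL : 0 < L)
    (hf : ∀ a, (f a).length = L) (as : List α) (x : ℕ) :
    (as.flatMap f)[x]? = as[x / L]?.bind fun a => (f a)[x % L]? := by
  induction as generalizing x with
  | nil => simp
  | cons a as ih =>
    rw [List.flatMap_cons]
    rcases lt_or_ge x L with h | h
    · rw [List.getElem?_append_left (by rwa [hf]), Nat.div_eq_of_lt h, Nat.mod_eq_of_lt h]
      rfl
    · rw [List.getElem?_append_right (by rwa [hf]), hf, ih, ← Nat.mod_eq_sub_mod h,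
        Nat.div_eq_sub_div hL h]
      rfl

theorem length_flatMap_of_forall {α β : Type} (f : α → List β) {L : ℕ}
    (hf : ∀ a, (f a).length = L) (as : List α) : (as.flatMap f).length = as.length * L := by
  simp [List.length_flatMap, hf]

variable {l : ℕ}

/-- The code of a vertex: its bits followed by a separator. -/
def vertexWord {S : Type} (bit : Bool → S) (v : Vertex l) (s : S) : List S :=
  (List.ofFn v).map bit ++ [s]

theorem length_vertexWord {S : Type} (bit : Bool → S) (v : Vertex l) (s : S) :
    (vertexWord bit v s).length = l + 1 := by
  simp [vertexWord]

theorem getElem?_vertexWord {S : Type} (bit : Bool → S) (v : Vertex l) (s : S) {k : ℕ}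
    (hk : k < l + 1) :
    (vertexWord bit v s)[k]? = some (if h : k < l then bit (v ⟨k, h⟩) else s) := by
  by_cases h : k < l
  · rw [vertexWord, List.getElem?_append_left (by simpa using h)]
    simp [h]
  · obtain rfl : k = l := by omega
    rw [vertexWord, List.getElem?_append_right (by simp)]
    simp

theorem encodeEdge_eq (e : Vertex l × Vertex l) : encodeEdge e =
    vertexWord InSymbol.bit e.1 .comma ++ vertexWord InSymbol.bit e.2 .semicolon := by
  simp [encodeEdge, vertexWord]

theorem length_encodeEdge (e : Vertex l × Vertex l) : (encodeEdge e).length = 2 * (l + 1) := by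
  rw [encodeEdge_eq, List.length_append, length_vertexWord, length_vertexWord, two_mul]

theorem length_encodeEdges (es : List (Vertex l × Vertex l)) :
    (encodeEdges es).length = 2 * es.length * (l + 1) := by
  rw [encodeEdges, length_flatMap_of_forall _ length_encodeEdge]
  ring

theorem encodeVertices_eq (p : List (Vertex l)) :
    encodeVertices p = p.flatMap fun v => vertexWord OutSymbol.bit v .comma := rfl

instance : Finite InSymbol :=
  Finite.of_injective (β := Bool ⊕ Bool)
    (fun | .bit b => .inl b | .comma => .inr false | .semicolon => .inr true)
    (by rintro (_ | _) (_ | _) h <;> simp_all)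

/-- The letter of a cell at its first activity. -/
def firstLetter : InSymbol → Letter
  | .bit b => .inl (b, false, false)
  | .comma => .inr .source
  | .semicolon => .inr .target

/-- Whether an input letter is a separator. -/
def isSeparator : InSymbol → Bool
  | .bit _ => false
  | .comma | .semicolon => true

/-- The output that a letter displays. -/
def display : Letter → OutSymbol
  | .inl b => if b.2.2 then .bit b.1 else .blank
  | .inr t => if t.shown then .comma else .blank

/-- The processors that represent a list of edges. -/
def firstProcs (es : List (Vertex l × Vertex l)) (j : ℕ) : Proc (Vertex l) :=
  let e := es.getD (j / 2) (fun _ => false, fun _ => false)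
  if j % 2 = 0 then ⟨.source, e.1, fun _ => false⟩ else ⟨.target, e.2, fun _ => false⟩

theorem getElem_encodeEdges (es : List (Vertex l × Vertex l)) (c : ℕ)
    (hc : c < (encodeEdges es).length) :
    rowLetters (firstProcs es) c = firstLetter (encodeEdges es)[c] ∧
      isSeparator (encodeEdges es)[c] = decide ((c + 1) % (l + 1) = 0) := by
  have hL : 0 < l + 1 := by omega
  have h1 := getElem?_flatMap encodeEdge (by omega) length_encodeEdge es c
  rw [← encodeEdges, List.getElem?_eq_getElem hc] at h1
  have hc' := hc
  rw [length_encodeEdges, show 2 * es.length * (l + 1) = es.length * (2 * (l + 1)) by ring,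
    ← Nat.div_lt_iff_lt_mul (by omega)] at hc'
  rw [List.getElem?_eq_getElem hc', Option.bind_some] at h1
  have hk := Nat.mod_lt c hL
  have hdiv : c / (2 * (l + 1)) = c / (l + 1) / 2 := by rw [mul_comm, Nat.div_div_eq_div_mul]
  have hmod : c % (2 * (l + 1)) = c % (l + 1) + (l + 1) * (c / (l + 1) % 2) := by
    rw [mul_comm 2, Nat.mod_mul]
  have hsep : decide ((c + 1) % (l + 1) = 0) = decide (¬ c % (l + 1) < l) := by
    rw [decide_eq_decide, succ_mod_eq_zero_iff hL]
    omega
  have he : es.getD (c / (l + 1) / 2) (fun _ => false, fun _ => false) =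
      es[c / (2 * (l + 1))] := by
    rw [← hdiv, List.getD_eq_getElem _ _ hc']
  rw [hsep, rowLetters, firstProcs, he]
  generalize es[c / (2 * (l + 1))] = e at h1 ⊢
  rw [encodeEdge_eq, hmod] at h1
  rcases Nat.mod_two_eq_zero_or_one (c / (l + 1)) with h2 | h2
  · rw [h2, mul_zero, add_zero, List.getElem?_append_left (by rwa [length_vertexWord]),
      getElem?_vertexWord _ _ _ hk, Option.some.injEq] at h1
    rw [h1, if_pos h2, cellLetter]
    by_cases h : c % (l + 1) < l <;> simp [h, firstLetter, isSeparator, Tag.shown]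
  · rw [h2, mul_one, List.getElem?_append_right (by rw [length_vertexWord]; omega),
      length_vertexWord, Nat.add_sub_cancel, getElem?_vertexWord _ _ _ hk, Option.some.injEq] at h1
    rw [h1, if_neg (by omega), cellLetter]
    by_cases h : c % (l + 1) < l <;> simp [h, firstLetter, isSeparator, Tag.shown]

/-- The automaton that reorders the edges of a path. -/
noncomputable def reorderAutomaton : WordAutomaton InSymbol OutSymbol :=
  simulator (twoPhase letterRule) (fun a => Sum.inl (firstLetter a)) isSeparator
    (fun x => display (currentLetter x)) .blank

theorem reorderAutomaton_proj (es : List (Vertex l × Vertex l)) (c : ℕ)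
    (hc : c < (encodeEdges es).length) (t : ℕ) :
    reorderAutomaton.proj (reorderAutomaton.site (encodeEdges es) c (c + 1 + t)) =
      display (rowLetters ((Proc.step (2 * es.length))^[t / (2 * (l + 1)) / 2] (firstProcs es)) c) := by
  have h1 := simulator_proj (twoPhase letterRule) (fun a => Sum.inl (firstLetter a)) isSeparator
    (fun x => display (currentLetter x)) .blank (encodeEdges es) (L := l + 1) (by omega)
    ⟨2 * es.length, by rw [length_encodeEdges, mul_comm]⟩ (Sum.inl ∘ rowLetters (firstProcs es))
    (fun c hc => congrArg Sum.inl (getElem_encodeEdges es c hc).1)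
    (fun c hc => (getElem_encodeEdges es c hc).2) c hc t
  rw [reorderAutomaton, h1, currentLetter_iterate, length_encodeEdges,
    iterate_fullStep_rowLetters _ _ _ _ (by rwa [← length_encodeEdges])]

theorem display_rowLetters (c : ℕ → Proc (Vertex l)) (i : ℕ) : display (rowLetters c i) =
    if (c (i / (l + 1))).tag.shown then
      (if h : i % (l + 1) < l then OutSymbol.bit ((c (i / (l + 1))).fst ⟨i % (l + 1), h⟩) else .comma)
    else .blank := by
  rw [rowLetters, cellLetter]
  by_cases h : i % (l + 1) < l <;> simp [h, display]

theorem length_of_isShuffledPath {V : Type} {p : List V} {es : List (V × V)}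
    (h : IsShuffledPath p es) : p.length = es.length + 1 ∧ 0 < es.length := by
  have h1 := h.2.2.length_eq
  have h2 := h.1
  rw [consecutiveEdges, List.length_zip, List.length_tail] at h1
  omega

theorem displayed_reorderAutomaton {p : List (Vertex l)} {es : List (Vertex l × Vertex l)}
    (h : IsShuffledPath p es) (t : ℕ) (ht : t = 14 * (encodeEdges es).length) :
    reorderAutomaton.displayed (encodeEdges es) t =
      (encodeVertices p).rightpad (encodeEdges es).length OutSymbol.blank := by
  classical
  obtain ⟨hp, hn⟩ := length_of_isShuffledPath h
  have hlen := length_encodeEdges es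
  have hplen : (encodeVertices p).length = (es.length + 1) * (l + 1) := by
    rw [encodeVertices_eq, length_flatMap_of_forall _ fun v => length_vertexWord _ v _, hp]
  -- The output fits because a path with at least one edge has `n + 1 ≤ 2 * n` vertices.
  have hle : (es.length + 1) * (l + 1) ≤ 2 * es.length * (l + 1) :=
    Nat.mul_le_mul_right _ (by omega)
  refine List.ext_getElem ?_ fun i hi hi' => ?_
  · rw [WordAutomaton.displayed, List.length_ofFn, List.rightpad, List.length_append,
      List.length_replicate]
    omega
  · have hic : i < (encodeEdges es).length := by simpa [WordAutomaton.displayed] using hi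
    obtain ⟨t', rfl⟩ : ∃ t', t = i + 1 + t' := ⟨t - (i + 1), by omega⟩
    -- With `n` edges the input length is `2 * n * (l + 1)`. Hence `6 * n` processor steps, each of
    -- two phases of `2 * (l + 1)` units, take 12 times this length. Every cell wakes up within one
    -- input length, so 14 leaves enough time.
    have hr : 6 * es.length ≤ t' / (2 * (l + 1)) / 2 := by
      rw [Nat.le_div_iff_mul_le (by omega), Nat.le_div_iff_mul_le (by omega),
        show 6 * es.length * 2 * (2 * (l + 1)) = 12 * (2 * es.length * (l + 1)) by ring, ← hlen]
      omega
    have hperm : ((List.range es.length).map fun j =>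
        ((firstProcs es (2 * j)).fst, (firstProcs es (2 * j + 1)).fst)).Perm
        (consecutiveEdges p) := by
      refine (List.Perm.of_eq ?_).trans h.2.2
      refine List.ext_getElem (by simp) fun j hj hj' => ?_
      have e1 : (2 * j + 1) / 2 = j := by omega
      simp [firstProcs, e1, hj']
    obtain ⟨h1, h2⟩ := reorder_procs h.2.1 hn _ _ hperm (c := firstProcs es)
      (fun j _ => ⟨by simp [firstProcs], rfl⟩) (fun j _ => ⟨by simp [firstProcs], rfl⟩) _ hr
    have hlhs : (reorderAutomaton.displayed (encodeEdges es) (i + 1 + t'))[i]'hi =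
        reorderAutomaton.proj (reorderAutomaton.site (encodeEdges es) i (i + 1 + t')) := by
      simp [WordAutomaton.displayed]
    rw [hlhs, reorderAutomaton_proj es i hic, display_rowLetters]
    rw [hlen] at hic
    have hj := (Nat.div_lt_iff_lt_mul (show 0 < l + 1 by omega)).2 hic
    rw [← Option.some_inj, ← List.getElem?_eq_getElem, List.rightpad]
    rcases lt_or_ge (i / (l + 1)) (es.length + 1) with h3 | h3
    · obtain ⟨h4, h5⟩ := h1 _ (Nat.lt_succ_iff.1 h3)
      rw [List.getElem?_append_left
        (by rwa [hplen, ← Nat.div_lt_iff_lt_mul (show 0 < l + 1 by omega)]), encodeVertices_eq,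
        getElem?_flatMap _ (by omega) fun v => length_vertexWord _ v _, h5, Option.bind_some,
        getElem?_vertexWord _ _ _ (Nat.mod_lt _ (by omega)), if_pos h4]
    · have h6 : (es.length + 1) * (l + 1) ≤ i := (Nat.le_div_iff_mul_le (by omega)).1 h3
      rw [h2 _ h3 hj, List.getElem?_append_right (by rwa [hplen]), List.getElem?_replicate,
        if_neg (by simp [Tag.shown]), if_pos (by omega)]

end Words
end EdgeReordering

theorem mainTheorem11 :
    ∃ φ : List EdgeReordering.InSymbol → List EdgeReordering.OutSymbol,
      EdgeReordering.ComputableInLinearTime φ ∧ EdgeReordering.SolvesEdgeReordering φ := by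
  -- Defining `φ` by what the automaton displays makes computability hold by definition, also on
  -- words that code no path.
  refine ⟨fun w => EdgeReordering.reorderAutomaton.displayed w ⌈(14 : ℚ) * (w.length : ℚ)⌉₊,
    ⟨14, by norm_num, EdgeReordering.reorderAutomaton, fun _ => rfl⟩, fun l p es h => ?_⟩
  refine EdgeReordering.displayed_reorderAutomaton h _ ?_
  rw [show (14 : ℚ) * ((EdgeReordering.encodeEdges es).length : ℚ) =
    ((14 * (EdgeReordering.encodeEdges es).length : ℕ) : ℚ) by push_cast; ring, Nat.ceil_natCast]
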